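/- Let $A$ be a finite alphabet with $|A|\ge 2$ and let $(X_t)_{t\in\mathbb Z}$ be a stationary ergodic process with values in $A$, with one-sided conditional probabilities $\mathbb P(X_0=a\mid X_{-\infty}^{-1}=x)$, $a\in A$, $x=x_{-\infty}^{-1}$ (a fixed version, defined for every $x$). For finite strings $s,w$ write $s\prec w$ if $s$ is a proper suffix of $w$ (also when $w$ is a semi-infinite sequence $w_{-\infty}^{-1}$), and $s\preceq w$ if $s\prec w$ or $s=w$; $\ell(w)$ is the length of $w$ and $\lambda$ the empty string. For a string $w$ of length $j$ put $p(a|w)=\mathbb P(X_0=a\mid X_{-j}^{-1}=w)$; for a semi-infinite $w$ put $p(a|w)=\mathbb P(X_0=a\mid X_{-\infty}^{-1}=w)$. A finite string $w$ (possibly $\lambda$) is a context if $\mathbb P(X_0=a\mid X_{-\infty}^{-1}=x)=p(a|w)$ for all $a\in A$ and all semi-infinite $x\succ w$, and no $s\prec w$ has this property; a semi-infinite sequence is an infinite context if none of its finite suffixes is a context. The context tree $\tau_0$ is the set of all finite and infinite contexts. Let $$\alpha_0=\inf_{w\in\tau_0,\,a\in A}p(a|w),\qquad \alpha_k=\inf_{u\in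 A^k}\sum_{a\in A}\inf_{w\in\tau_0,\,w\succ u}p(a|w)\quad(k\ge1),$$ where a string $u$ that is a context or ends in a context $w\preceq u$ contributes $\sum_a p(a|w)=1$ to the outer infimum. Assume $\alpha_0>0$ and $\sum_{k}(1-\alpha_k)<\infty$. A tree is a set of sequences none of which is a proper suffix of another; it is complete if every semi-infinite sequence has a suffix in it or belongs to it. For a set $\tau$ of sequences let $\tau|_K=\{w\in\tau:\ell(w)\le K\}\cup\{w:\ell(w)=K,\ w\prec u\text{ for some }u\in\tau\}$ and $\mathrm{Int}(\tau)=\{w: w\prec u\text{ for some }u\in\tau\}$. Let $d:\mathbb N\to\mathbb N$ with $d(n)<n$ for $n\ge1$ and $d(n)\to\infty$, and let $f:\mathbb N\to(0,\infty)$ with $f(n)\to\infty$ and $f(n)/n\to0$; write $d=d(n)$. For a sample $x_1^n$ let $N_n(w,a)=\#\{t\in\{d+1,\dots,n\}: x_{t-\ell(w)}^{t-1}=w,\ x_t=a\}$ and $N_n(w)=\sum_aN_n(w,a)$, for $\ell(w)\le d$. A tree $\tau$ is feasible if it is complete, its elements have length at most $d$, $N_n(w)\ge1$ for all $w\in\tau$,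 and every string $w'$ with $\ell(w')\le d$ and $N_n(w')\ge1$ belongs to $\tau$, is a suffix of an element of $\tau$ or has a suffix in $\tau$. Let $\hat\tau(x_1^n)$ be a feasible tree minimizing $$-\log\prod_{w\in\tau}\prod_{a\in A}\Bigl(\frac{N_n(w,a)}{N_n(w)}\Bigr)^{N_n(w,a)}+|\tau|f(n)$$ over all feasible trees $\tau$ (with $0^0=1$, ties being broken arbitrarily). For $K\in\mathbb N$ let $$U_n^K=\bigcup_{w\in\mathrm{Int}(\tau_0|_K)}\{w\in\hat\tau(X_1^n)\},\qquad O_n^K=\bigcup_{w\succ v\in\tau_0,\ \ell(v)<K}\{w\in\hat\tau(X_1^n)\}.$$ Theorem. For every $K\in\mathbb N$ there are positive constants $c_1,c_2,c_3,c_4$, depending only on the process and on $K$, such that for all $d$, $f$ and $\hat\tau$ as above there is an integer $n_0$ such that for all $n\ge n_0$: (a) if moreover $f(m)/(m-d(m))\to0$ as $m\to\infty$, then $\mathbb P[U_n^K]\le c_1e^{-c_2(n-d)}$; (b) $\mathbb P[O_n^K]\le c_3|A|^d\exp\bigl(-c_4f(n)(\alpha_0^2/|A|)^d/d\bigr)$.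 -/

import Mathlib

open MeasureTheory ProbabilityTheory Filter Topology

noncomputable section

namespace PLTree

/-! ### Strings and trees

A finite string `w_m^n` is the list `[w_m, …, w_n]`, so that `vw` is `v ++ w`.
A semi-infinite sequence `(…, x_{-2}, x_{-1})` is the function `x : ℕ → A`
with `x i` standing for `x_{-(i+1)}`. -/

/-- Finite strings (`Sum.inl`) and semi-infinite sequences (`Sum.inr`). -/
abbrev Str (A : Type*) := List A ⊕ (ℕ → A)

/-- The string `(x_{-k}, …, x_{-1})` of the last `k` symbols of a semi-infinite sequence. -/
def lastSymbols {A : Type*} (x : ℕ → A) (k : ℕ) : List A :=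
  (List.ofFn fun i : Fin k => x i).reverse

/-- Length of a finite or semi-infinite sequence. -/
def len {A : Type*} : Str A → ℕ∞
  | Sum.inl w => w.length
  | Sum.inr _ => ⊤

/-- `s ≺ w`: the finite string `s` is a (proper) suffix of `w`. -/
def ProperSuffix {A : Type*} (s : List A) : Str A → Prop
  | Sum.inl w => ∃ u : List A, u ≠ [] ∧ w = u ++ s
  | Sum.inr x => lastSymbols x s.length = s

/-- `v ⪯ w`: either `v = w` or `v ≺ w` (a proper suffix is always a finite string). -/
def SuffixEq {A : Type*} (v w : Str A) : Prop :=
  v = w ∨ ∃ s : List A, v = Sum.inl s ∧ ProperSuffix s w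

/-- A tree: a set of finite or semi-infinite sequences with the suffix property. -/
def IsTree {A : Type*} (τ : Set (Str A)) : Prop :=
  ∀ s : List A, Sum.inl s ∈ τ → ∀ w ∈ τ, ¬ ProperSuffix s w

/-- Height `h(τ)`. -/
def height {A : Type*} (τ : Set (Str A)) : ℕ∞ := ⨆ w ∈ τ, len w

/-- Completeness: every semi-infinite sequence has a (weak) suffix in the tree. -/
def IsComplete {A : Type*} (τ : Set (Str A)) : Prop :=
  ∀ x : ℕ → A, ∃ s ∈ τ, SuffixEq s (Sum.inr x)

/-- The tree truncated to level `K`, written `τ|_K`. -/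
def trunc {A : Type*} (τ : Set (Str A)) (K : ℕ) : Set (Str A) :=
  {w | w ∈ τ ∧ len w ≤ K} ∪
    {w | ∃ s : List A, w = Sum.inl s ∧ s.length = K ∧ ∃ u ∈ τ, ProperSuffix s u}

/-- `Int(τ)`: the strings that are proper suffixes of some element of `τ`. -/
def interior {A : Type*} (τ : Set (Str A)) : Set (List A) :=
  {w | ∃ u ∈ τ, ProperSuffix w u}

/-- A finite set of finite strings, as a set of finite or semi-infinite sequences. -/
def asTree {A : Type*} (τ : Finset (List A)) : Set (Str A) := {w | ∃ s ∈ τ, w = Sum.inl s}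

/-! ### The process, its contexts and its continuity rates -/

section Chain

variable {Ω A : Type*} [MeasurableSpace Ω] [MeasurableSpace A]

/-- The two-sided process `X` is stationary and ergodic: its law on `A^ℤ` is invariant and
ergodic under the shift. -/
structure IsStationaryErgodic (P : Measure Ω) (X : ℤ → Ω → A) : Prop where
  measurable : ∀ t, Measurable (X t)
  ergodic : Ergodic (fun (x : ℤ → A) (t : ℤ) => x (t + 1)) (P.map fun ω t => X t ω)

/-- The infinite past `X_{-∞}^{-1}`. -/
def past (X : ℤ → Ω → A) (ω : Ω) : ℕ → A := fun i => X (-((i : ℤ) + 1)) ω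

/-- The sample `X_1^n = (X_1, …, X_n)`. -/
def sample (X : ℤ → Ω → A) (n : ℕ) (ω : Ω) : List A :=
  List.ofFn fun i : Fin n => X ((i : ℤ) + 1) ω

/-- `q` is a version of the conditional probabilities
`x ↦ P(X_0 = · | X_{-∞}^{-1} = x)`. -/
def IsTransitionVersion (P : Measure Ω) (X : ℤ → Ω → A) (q : Kernel (ℕ → A) A) : Prop :=
  ∀ a : A, P⟦{ω | X 0 ω = a} | MeasurableSpace.comap (past X) inferInstance⟧
    =ᵐ[P] fun ω => (q (past X ω)).real {a}

/-- `p(a|w) = P(X_0 = a | X_{-j}^{-1} = w)` for a finite string `w` of length `j`. -/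
def condProbWord (P : Measure Ω) (X : ℤ → Ω → A) (w : List A) (a : A) : ℝ :=
  (P[|{ω | lastSymbols (past X ω) w.length = w}]).real {ω | X 0 ω = a}

/-- Given any past ending in `w`, the next symbol has law `p(·|w)`.  (A string `w` of
probability zero never satisfies this: then `condProbWord` vanishes, while `q x` has mass 1.) -/
def Determines (P : Measure Ω) (X : ℤ → Ω → A) (q : Kernel (ℕ → A) A) (w : List A) : Prop :=
  ∀ x : ℕ → A, lastSymbols x w.length = w → ∀ a : A, (q x).real {a} = condProbWord P X w a

/-- A finite context: it determines the law of the next symbol and no proper suffix does. -/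
def IsContext (P : Measure Ω) (X : ℤ → Ω → A) (q : Kernel (ℕ → A) A) (w : List A) : Prop :=
  Determines P X q w ∧ ∀ s : List A, ProperSuffix s (Sum.inl w) → ¬ Determines P X q s

/-- An infinite context: a semi-infinite sequence none of whose finite suffixes is a context. -/
def IsInfContext (P : Measure Ω) (X : ℤ → Ω → A) (q : Kernel (ℕ → A) A) (x : ℕ → A) : Prop :=
  ∀ k : ℕ, ¬ IsContext P X q (lastSymbols x k)

/-- The context tree `τ₀` of the process: all finite and infinite contexts. -/
def contextTree (P : Measure Ω) (X : ℤ → Ω → A) (q : Kernel (ℕ → A) A) : Set (Str A)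
  | Sum.inl w => IsContext P X q w
  | Sum.inr x => IsInfContext P X q x

/-- `p(a|w)` for a finite or semi-infinite `w`. -/
def condProb (P : Measure Ω) (X : ℤ → Ω → A) (q : Kernel (ℕ → A) A) : Str A → A → ℝ
  | Sum.inl w, a => condProbWord P X w a
  | Sum.inr x, a => (q x).real {a}

/-- The numbers `α_k`.  For `k ≥ 1` the inner infimum runs over the elements of `τ₀` that are
comparable with `u`, that is over the `w ≻ u` and, if `u` already ends in a context,
over this context; such a `u` contributes `∑ₐ p(a|w) = 1`. -/
def alpha [Fintype A] (P : Measure Ω) (X : ℤ → Ω → A) (q : Kernel (ℕ → A) A) : ℕ → ℝ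
  | 0 => ⨅ wa : {w : Str A // w ∈ contextTree P X q} × A, condProb P X q wa.1.1 wa.2
  | k + 1 => ⨅ u : {u : List A // u.length = k + 1}, ∑ a : A,
      ⨅ w : {w : Str A // w ∈ contextTree P X q ∧
          (ProperSuffix u.1 w ∨ SuffixEq w (Sum.inl u.1))},
        condProb P X q w.1 a

/-- Positivity and summable loss of memory: `α₀ > 0` and `∑ₖ (1 - αₖ) < ∞`. -/
structure Regular [Fintype A] (P : Measure Ω) (X : ℤ → Ω → A) (q : Kernel (ℕ → A) A) :
    Prop where
  alpha_zero_pos : 0 < alpha P X q 0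
  summable : Summable fun k : ℕ => 1 - alpha P X q k

end Chain

/-! ### The penalized likelihood estimator

A sample `x_1^n` is a list `x` of length `n`; `x.take t` is `x_1^t`. -/

section Estimator

variable {A : Type*} [Fintype A] [DecidableEq A]

/-- `N_n(w,a)`: number of `t ∈ {d+1,…,n}` such that `x_{t-ℓ(w)}^{t-1} = w` and `x_t = a`. -/
def countNext (d : ℕ) (x : List A) (w : List A) (a : A) : ℕ :=
  ((Finset.Icc (d + 1) x.length).filter fun t => (w ++ [a]) <:+ x.take t).card

/-- `N_n(w) = ∑ₐ N_n(w,a)`. -/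
def count (d : ℕ) (x : List A) (w : List A) : ℕ := ∑ a : A, countNext d x w a

/-- Feasible trees for the sample `x` and the maximal height `d`. -/
structure IsFeasible (d : ℕ) (x : List A) (τ : Finset (List A)) : Prop where
  isTree : IsTree (asTree τ)
  isComplete : IsComplete (asTree τ)
  height_le : height (asTree τ) ≤ d
  occurs : ∀ w ∈ τ, 1 ≤ count d x w
  covers : ∀ w' : List A, w'.length ≤ d → 1 ≤ count d x w' →
    w' ∈ τ ∨ (∃ w ∈ τ, ProperSuffix w' (Sum.inl w)) ∨ ∃ w ∈ τ, ProperSuffix w (Sum.inl w')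

/-- Maximum likelihood `∏_{w∈τ} ∏_a p̂_n(a|w)^{N_n(w,a)}`, where
`p̂_n(a|w) = N_n(w,a) / N_n(w)`. -/
def maxLik (d : ℕ) (x : List A) (τ : Finset (List A)) : ℝ :=
  ∏ w ∈ τ, ∏ a : A, ((countNext d x w a : ℝ) / (count d x w : ℝ)) ^ countNext d x w a

/-- The penalized criterion `-log P̂_{ML,τ}(x_1^n) + |τ| c`, with penalty `c` per leaf. -/
def penCost (d : ℕ) (c : ℝ) (x : List A) (τ : Finset (List A)) : ℝ :=
  -Real.log (maxLik d x τ) + (τ.card : ℝ) * c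

/-- `est` is a penalized likelihood estimator: for every non-empty sample it returns a feasible
tree minimizing the penalized criterion (with an arbitrary choice in case of ties). -/
def IsPLEstimator (d : ℕ → ℕ) (f : ℕ → ℝ) (est : List A → Finset (List A)) : Prop :=
  ∀ x : List A, x ≠ [] →
    IsFeasible (d x.length) x (est x) ∧
    ∀ τ : Finset (List A), IsFeasible (d x.length) x τ →
      penCost (d x.length) (f x.length) x (est x) ≤ penCost (d x.length) (f x.length) x τ

end Estimator

/-- Penalizing terms. -/
structure IsPenalizing (f : ℕ → ℝ) : Prop where
  pos : ∀ n, 0 < f n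
  tendsto_atTop : Tendsto f atTop atTop
  tendsto_div : Tendsto (fun n : ℕ => f n / n) atTop (𝓝 0)

/-- Admissible maximal heights: `d(n) < n` and `d(n) → ∞`. -/
structure IsMaxHeight (d : ℕ → ℕ) : Prop where
  lt : ∀ n, 1 ≤ n → d n < n
  tendsto_atTop : Tendsto d atTop atTop

/-- Underestimation event: some element of `Int(τ₀|_K)` is a leaf of the estimated tree. -/
def underEvent {Ω A : Type*} (X : ℤ → Ω → A) (τ₀ : Set (Str A))
    (est : List A → Finset (List A)) (K n : ℕ) : Set Ω :=
  {ω | ∃ w ∈ interior (trunc τ₀ K), w ∈ est (sample X n ω)}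

/-- Overestimation event: the estimated tree has a leaf `w ≻ v` with `v ∈ τ₀`, `ℓ(v) < K`. -/
def overEvent {Ω A : Type*} (X : ℤ → Ω → A) (τ₀ : Set (Str A))
    (est : List A → Finset (List A)) (K n : ℕ) : Set Ω :=
  {ω | ∃ v w : List A, Sum.inl v ∈ τ₀ ∧ v.length < K ∧ ProperSuffix v (Sum.inl w) ∧
    w ∈ est (sample X n ω)}

end PLTree

end

/-! The estimated tree is at least as good as every feasible tree, so each kind of error is refuted
by one competing tree, outside events controlled by exponential inequalities.

Underestimation. A string `w` in the interior of the truncated context tree does not determine the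
next symbol, so two pasts ending in `w` have different transition probabilities
(`exists_lt_of_not_determines`). Summability forces `α_k → 1`, hence these probabilities depend on
the last `k` symbols up to a small error (`kernel_real_sub_le`), and two extensions of `w` of some
fixed length have separated empirical distributions. When all extensions of that length occur
linearly often, splitting the leaf `w` into them gains log-likelihood of order `n - d` (`le_gain`),
while optimality caps the gain by a constant times `f(n) = o(n - d)` (`IsFeasible.gain_le`). Only
finitely many `w` matter.

Overestimation. If a leaf lies strictly above a context `v`, then at least two leaves do, and
collapsing them into `v` saves penalty. Optimality yields a leaf `u` above `v` whose maximal
log-likelihood exceeds that of `p(·|v)` by at least `f(n)/2` (`IsFeasible.exists_far_leaf`). By the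
`χ²` bound some count `N(u,a)` is then off from `p(a|v) N(u)` by at least order `√(f(n) N(u))`. All
pasts ending in `u` have the same transition law, so this is a pure fluctuation
(`measureReal_far_le`); a union bound over at most `2|A|^d` strings finishes.

Probability. Events of the sample are bounded by sums over words of weights `P(h) G(h)`; a weight
whose total does not increase when a letter is appended acts as a supermartingale
(`extSum_le_self`). An exponential weight in `N(u,a) - r N(u)` gives the deviation bounds. The
weight `exp(-N(u))`, followed over blocks in which `u` appears with conditional probability at least
`α₀ ^ ℓ(u)`, gives the lower tail of `N(u)`. -/

namespace PLTree

/-! ### Suffix order on finite and semi-infinite strings. -/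

section Suffixes

variable {A : Type*}

theorem lastSymbols_length (x : ℕ → A) (k : ℕ) : (lastSymbols x k).length = k := by
  simp [lastSymbols]

theorem lastSymbols_succ (x : ℕ → A) (k : ℕ) :
    lastSymbols x (k + 1) = x k :: lastSymbols x k := by
  rw [lastSymbols, List.ofFn_succ_last]
  simp [lastSymbols]

theorem lastSymbols_suffix (x : ℕ → A) {j k : ℕ} (h : j ≤ k) :
    lastSymbols x j <:+ lastSymbols x k := by
  induction k, h using Nat.le_induction with
  | base => exact List.suffix_refl _
  | succ k _ ih =>
    rw [lastSymbols_succ]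
    exact ih.trans (List.suffix_cons _ _)

/-- The semi-infinite sequence `x` ends in the finite string `s`. -/
def EndsIn (x : ℕ → A) (s : List A) : Prop := lastSymbols x s.length = s

theorem endsIn_lastSymbols (x : ℕ → A) (k : ℕ) : EndsIn x (lastSymbols x k) := by
  simp [EndsIn, lastSymbols_length]

theorem EndsIn.suffix_lastSymbols {x : ℕ → A} {s : List A} (h : EndsIn x s) {k : ℕ}
    (hk : s.length ≤ k) : s <:+ lastSymbols x k := by
  rw [EndsIn] at h
  rw [← h]
  exact lastSymbols_suffix x hk

theorem EndsIn.of_suffix {x : ℕ → A} {s w : List A} (h : EndsIn x w) (hs : s <:+ w) :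
    EndsIn x s := by
  have h1 : lastSymbols x s.length <:+ w := by
    have := lastSymbols_suffix x hs.length_le
    rwa [show lastSymbols x w.length = w from h] at this
  exact (List.suffix_of_suffix_length_le h1 hs (by simp [lastSymbols_length])).eq_of_length
    (lastSymbols_length _ _)

theorem EndsIn.suffix_of_length_le {x : ℕ → A} {s w : List A} (hs : EndsIn x s)
    (hw : EndsIn x w) (h : s.length ≤ w.length) : s <:+ w := by
  have := hs.suffix_lastSymbols h
  rwa [show lastSymbols x w.length = w from hw] at this

theorem EndsIn.comparable {x : ℕ → A} {s w : List A} (hs : EndsIn x s) (hw : EndsIn x w) :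
    s <:+ w ∨ w <:+ s :=
  (le_total s.length w.length).imp (hs.suffix_of_length_le hw) (hw.suffix_of_length_le hs)

theorem exists_endsIn [Nonempty A] (w : List A) : ∃ x : ℕ → A, EndsIn x w := by
  induction w with
  | nil => exact ⟨fun _ => Classical.arbitrary A, rfl⟩
  | cons b w ih =>
    obtain ⟨x, hx⟩ := ih
    refine ⟨Function.update x w.length b, ?_⟩
    have key : ∀ k, k ≤ w.length →
        lastSymbols (Function.update x w.length b) k = lastSymbols x k := by
      intro k
      induction k with
      | zero => intro _; rfl
      | succ k ih =>
        intro hk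
        rw [lastSymbols_succ, lastSymbols_succ, ih (by omega),
          Function.update_of_ne (by omega)]
    rw [EndsIn, List.length_cons, lastSymbols_succ, key _ le_rfl, Function.update_self]
    rw [show lastSymbols x w.length = w from hx]

theorem suffix_comparable {s t w : List A} (hs : s <:+ w) (ht : t <:+ w) : s <:+ t ∨ t <:+ s :=
  (le_total s.length t.length).imp (List.suffix_of_suffix_length_le hs ht)
    (List.suffix_of_suffix_length_le ht hs)

theorem properSuffix_inl_iff {s w : List A} :
    ProperSuffix s (Sum.inl w) ↔ s <:+ w ∧ s ≠ w := by
  constructor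
  · rintro ⟨u, hu, rfl⟩
    refine ⟨List.suffix_append _ _, fun h => hu ?_⟩
    simpa using h
  · rintro ⟨⟨u, rfl⟩, hne⟩
    exact ⟨u, by rintro rfl; simp at hne, rfl⟩

theorem suffixEq_inl_inl {s w : List A} :
    SuffixEq (Sum.inl s) (Sum.inl w) ↔ s <:+ w := by
  constructor
  · rintro (h | ⟨t, h, ht⟩)
    · rw [Sum.inl.inj h]
    · rw [Sum.inl.inj h]; exact (properSuffix_inl_iff.1 ht).1
  · intro h
    by_cases hne : s = w
    · exact Or.inl (by rw [hne])
    · exact Or.inr ⟨s, rfl, properSuffix_inl_iff.2 ⟨h, hne⟩⟩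

theorem suffixEq_inl_inr {s : List A} {x : ℕ → A} :
    SuffixEq (Sum.inl s) (Sum.inr x) ↔ EndsIn x s := by
  constructor
  · rintro (h | ⟨t, h, ht⟩)
    · simp at h
    · rw [Sum.inl.inj h]; exact ht
  · intro h
    exact Or.inr ⟨s, rfl, h⟩

theorem isTree_asTree_iff {τ : Finset (List A)} :
    IsTree (asTree τ) ↔ ∀ s ∈ τ, ∀ w ∈ τ, s <:+ w → s = w := by
  constructor
  · intro h s hs w hw hsw
    by_contra hne
    exact h s ⟨s, hs, rfl⟩ _ ⟨w, hw, rfl⟩ (properSuffix_inl_iff.2 ⟨hsw, hne⟩)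
  · rintro h s ⟨s', hs', hss⟩ _ ⟨w, hw, rfl⟩ hsw
    obtain ⟨h1, h2⟩ := properSuffix_inl_iff.1 hsw
    rw [← Sum.inl.inj hss] at hs'
    exact h2 (h s hs' w hw h1)

theorem isComplete_asTree_iff {τ : Finset (List A)} :
    IsComplete (asTree τ) ↔ ∀ x : ℕ → A, ∃ s ∈ τ, EndsIn x s := by
  constructor
  · intro h x
    obtain ⟨_, ⟨s, hs, rfl⟩, hsx⟩ := h x
    exact ⟨s, hs, suffixEq_inl_inr.1 hsx⟩
  · intro h x
    obtain ⟨s, hs, hsx⟩ := h x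
    exact ⟨_, ⟨s, hs, rfl⟩, suffixEq_inl_inr.2 hsx⟩

theorem height_asTree_le_iff {τ : Finset (List A)} {d : ℕ} :
    height (asTree τ) ≤ d ↔ ∀ w ∈ τ, w.length ≤ d := by
  simp only [height, iSup_le_iff]
  constructor
  · intro h w hw
    exact ENat.natCast_le_natCast.1 (h _ ⟨w, hw, rfl⟩)
  · rintro h _ ⟨w, hw, rfl⟩
    simpa [len] using h w hw

theorem concat_suffix_concat_iff {w x : List A} {a b : A} :
    w ++ [a] <:+ x ++ [b] ↔ w <:+ x ∧ a = b := by
  constructor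
  · rintro ⟨u, hu⟩
    rw [← List.append_assoc] at hu
    have := List.append_inj' hu rfl
    exact ⟨⟨u, this.1⟩, by simpa using this.2⟩
  · rintro ⟨⟨u, rfl⟩, rfl⟩
    exact ⟨u, by simp⟩

end Suffixes

/-! ### Counts, computed recursively in the sample. -/

section Counts

variable {A : Type*} [DecidableEq A]

theorem countNext_nil (d : ℕ) (w : List A) (a : A) : countNext d [] w a = 0 := by
  simp [countNext]

/-- Every later argument about counts uses this one-letter recursion instead of the set of
positions. The condition `d ≤ x.length` reflects that counting starts at position `d + 1`. -/
theorem countNext_concat (d : ℕ) (x w : List A) (a b : A) :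
    countNext d (x ++ [b]) w a =
      countNext d x w a + if d ≤ x.length ∧ w <:+ x ∧ a = b then 1 else 0 := by
  have h1 : ∀ t ∈ Finset.Icc (d + 1) x.length, (x ++ [b]).take t = x.take t := by
    intro t ht
    rw [List.take_append_of_le_length (Finset.mem_Icc.1 ht).2]
  by_cases hd : d ≤ x.length
  · rw [countNext, countNext, List.length_append, List.length_singleton,
      ← Finset.insert_Icc_right_eq_Icc_add_one (by omega), Finset.filter_insert]
    have h2 : (x ++ [b]).take (x.length + 1) = x ++ [b] := by
      rw [List.take_of_length_le (by simp)]
    have h3 : Finset.filter (fun t => w ++ [a] <:+ (x ++ [b]).take t)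
        (Finset.Icc (d + 1) x.length) = Finset.filter (fun t => w ++ [a] <:+ x.take t)
        (Finset.Icc (d + 1) x.length) :=
      Finset.filter_congr fun t ht => by rw [h1 t ht]
    rw [h2, h3]
    simp only [concat_suffix_concat_iff, hd, true_and]
    split_ifs with h
    · rw [Finset.card_insert_of_notMem (by simp)]
    · rfl
  · rw [countNext, countNext, Finset.Icc_eq_empty (by simp; omega),
      Finset.Icc_eq_empty (by omega)]
    simp [hd]

theorem countNext_anti (d : ℕ) (x : List A) {w w' : List A} (h : w <:+ w') (a : A) :
    countNext d x w' a ≤ countNext d x w a := by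
  induction x using List.reverseRecOn with
  | nil => simp [countNext_nil]
  | append_singleton x b ih =>
    rw [countNext_concat, countNext_concat]
    refine add_le_add ih ?_
    split_ifs with h1 h2
    · rfl
    · exact absurd ⟨h1.1, h.trans h1.2.1, h1.2.2⟩ h2
    · simp
    · rfl

/-- At each counted position at least `d` symbols precede, so it suffices that `S` partitions the
occurrences of `v` at the end of histories of length at least `d`. -/
theorem countNext_eq_sum (d : ℕ) (x : List A) (v : List A) (S : Finset (List A))
    (h : ∀ y : List A, d ≤ y.length →
      (if v <:+ y then 1 else 0) = ∑ u ∈ S, if u <:+ y then 1 else 0) (a : A) :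
    countNext d x v a = ∑ u ∈ S, countNext d x u a := by
  induction x using List.reverseRecOn with
  | nil => simp [countNext_nil]
  | append_singleton x b ih =>
    simp only [countNext_concat, Finset.sum_add_distrib, ih]
    congr 1
    by_cases hc : d ≤ x.length ∧ a = b
    · simpa [hc.1, hc.2] using h x hc.1
    · rw [if_neg (by tauto), Finset.sum_eq_zero]
      exact fun u _ => if_neg (by tauto)

variable [Fintype A]

theorem count_nil (d : ℕ) (w : List A) : count d [] w = 0 := by
  simp [count, countNext_nil]

theorem count_concat (d : ℕ) (x w : List A) (b : A) :
    count d (x ++ [b]) w = count d x w + if d ≤ x.length ∧ w <:+ x then 1 else 0 := by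
  simp only [count, countNext_concat, Finset.sum_add_distrib]
  congr 1
  by_cases h : d ≤ x.length ∧ w <:+ x
  · simp [h]
  · simp only [h, if_false]
    refine Finset.sum_eq_zero fun a _ => if_neg ?_
    tauto

theorem count_le_length (d : ℕ) (x w : List A) : count d x w ≤ x.length := by
  induction x using List.reverseRecOn with
  | nil => simp [count_nil]
  | append_singleton x b ih =>
    rw [count_concat, List.length_append, List.length_singleton]
    split_ifs <;> omega

theorem countNext_le_count (d : ℕ) (x w : List A) (a : A) : countNext d x w a ≤ count d x w :=
  Finset.single_le_sum (f := fun a => countNext d x w a) (fun _ _ => Nat.zero_le _)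
    (Finset.mem_univ a)

theorem count_anti (d : ℕ) (x : List A) {w w' : List A} (h : w <:+ w') :
    count d x w' ≤ count d x w :=
  Finset.sum_le_sum fun a _ => countNext_anti d x h a

theorem count_le_count_append (d : ℕ) (x y w : List A) : count d x w ≤ count d (x ++ y) w := by
  induction y using List.reverseRecOn with
  | nil => simp
  | append_singleton y b ih =>
    rw [← List.append_assoc, count_concat]
    omega

end Counts

/-! ### Log-likelihood at a leaf and its divergence from a given law. -/

section Likelihood

variable {A : Type*} [Fintype A] [DecidableEq A]

/-- The maximal log-likelihood `∑ₐ N(w,a) log (N(w,a) / N(w))` at the string `w`. -/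
noncomputable def logLik (d : ℕ) (x w : List A) : ℝ :=
  ∑ a : A, (countNext d x w a : ℝ) * Real.log ((countNext d x w a : ℝ) / (count d x w : ℝ))

theorem cast_count (d : ℕ) (x w : List A) :
    (count d x w : ℝ) = ∑ a : A, (countNext d x w a : ℝ) := by
  simp [count]

theorem log_maxLik (d : ℕ) (x : List A) (τ : Finset (List A)) :
    Real.log (maxLik d x τ) = ∑ w ∈ τ, logLik d x w := by
  have hne : ∀ (w : List A) (a : A),
      ((countNext d x w a : ℝ) / (count d x w : ℝ)) ^ countNext d x w a ≠ 0 := by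
    intro w a
    rcases Nat.eq_zero_or_pos (countNext d x w a) with h | h
    · simp [h]
    · have h2 : 0 < count d x w := h.trans_le (countNext_le_count d x w a)
      positivity
  rw [maxLik, Real.log_prod fun w _ => Finset.prod_ne_zero_iff.2 fun a _ => hne w a]
  refine Finset.sum_congr rfl fun w _ => ?_
  rw [Real.log_prod fun a _ => hne w a, logLik]
  simp [Real.log_pow]

theorem penCost_eq (d : ℕ) (c : ℝ) (x : List A) (τ : Finset (List A)) :
    penCost d c x τ = -∑ w ∈ τ, logLik d x w + (τ.card : ℝ) * c := by
  rw [penCost, log_maxLik]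

/-- Upper bound of the empirical divergence from `p` by the `χ²` distance. -/
theorem logLik_sub_le_chiSq (d : ℕ) (x w : List A) (p : A → ℝ) (hp : ∀ a, 0 < p a)
    (hp1 : ∑ a, p a = 1) (hw : 1 ≤ count d x w) :
    logLik d x w - ∑ a, (countNext d x w a : ℝ) * Real.log (p a) ≤
      ∑ a, ((countNext d x w a : ℝ) - p a * count d x w) ^ 2 / (p a * count d x w) := by
  have hN : (0 : ℝ) < count d x w := by exact_mod_cast hw
  have hterm : ∀ a, (countNext d x w a : ℝ) *
        Real.log ((countNext d x w a : ℝ) / (count d x w : ℝ)) -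
      (countNext d x w a : ℝ) * Real.log (p a) ≤
      ((countNext d x w a : ℝ) - p a * count d x w) ^ 2 / (p a * count d x w)
        + (countNext d x w a - p a * count d x w) := by
    intro a
    have hpa := hp a
    -- The right side is what `log t ≤ t - 1` gives at `t = p̂/p`; the linear part of the left side
    -- sums to zero over `a`.
    have hR : ((countNext d x w a : ℝ) - p a * count d x w) ^ 2 / (p a * count d x w)
        + (countNext d x w a - p a * count d x w) =
        (countNext d x w a : ℝ) * ((countNext d x w a : ℝ) / count d x w / p a - 1) := by
      field_simp
      ring
    rw [hR]
    rcases Nat.eq_zero_or_pos (countNext d x w a) with h | h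
    · simp [h]
    · have h' : (0 : ℝ) < countNext d x w a := by exact_mod_cast h
      rw [← mul_sub, ← Real.log_div (by positivity) (by positivity)]
      exact mul_le_mul_of_nonneg_left (Real.log_le_sub_one_of_pos (by positivity)) h'.le
  calc logLik d x w - ∑ a, (countNext d x w a : ℝ) * Real.log (p a)
      = ∑ a, ((countNext d x w a : ℝ) *
        Real.log ((countNext d x w a : ℝ) / (count d x w : ℝ)) -
      (countNext d x w a : ℝ) * Real.log (p a)) := by
        rw [logLik, Finset.sum_sub_distrib]
    _ ≤ ∑ a, (((countNext d x w a : ℝ) - p a * count d x w) ^ 2 / (p a * count d x w)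
        + (countNext d x w a - p a * count d x w)) := Finset.sum_le_sum fun a _ => hterm a
    _ = _ := by
        rw [Finset.sum_add_distrib, Finset.sum_sub_distrib, ← cast_count, ← Finset.sum_mul, hp1]
        ring

/-- Lower bound of the empirical divergence from `p` by a squared deviation. -/
theorem sq_le_logLik_sub (d : ℕ) (x w : List A) (p : A → ℝ) (hp : ∀ a, 0 ≤ p a)
    (hp1 : ∑ a, p a = 1) (hpos : ∀ a, 0 < countNext d x w a → 0 < p a)
    (hw : 1 ≤ count d x w) (a : A) :
    (count d x w : ℝ) * ((countNext d x w a : ℝ) / count d x w - p a) ^ 2 / 4 ≤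
      logLik d x w - ∑ b, (countNext d x w b : ℝ) * Real.log (p b) := by
  set N : ℝ := (count d x w : ℝ) with hNdef
  have hN : 0 < N := by rw [hNdef]; exact_mod_cast hw
  set r : A → ℝ := fun b => (countNext d x w b : ℝ) / N with hr
  have hr0 : ∀ b, 0 ≤ r b := fun b => by positivity
  have hrN : ∀ b, (countNext d x w b : ℝ) = N * r b := fun b => by
    simp only [hr]; field_simp
  have hr1 : ∑ b, r b = 1 := by
    simp only [hr]
    rw [← Finset.sum_div, ← cast_count, div_self hN.ne']
  -- Comparison with the Hellinger distance: `log t ≤ t - 1` is used at `t = √(p/r)`, and the terms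
  -- `r - p` cancel in the sum.
  have hterm : ∀ b, N * ((√(r b) - √(p b)) ^ 2 + r b - p b) ≤
      (countNext d x w b : ℝ) * Real.log (r b) - (countNext d x w b : ℝ) * Real.log (p b) := by
    intro b
    have hexp : (√(r b) - √(p b)) ^ 2 + r b - p b = 2 * r b - 2 * (√(r b) * √(p b)) := by
      have h1 := Real.sq_sqrt (hr0 b)
      have h2 := Real.sq_sqrt (hp b)
      linear_combination h1 + h2
    rw [hexp]
    rcases Nat.eq_zero_or_pos (countNext d x w b) with h | h
    · have h0 : r b = 0 := by simp [hr, h]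
      simp [h, h0]
    · have hpb := hpos b h
      have hrb : 0 < r b := by
        have : (0 : ℝ) < countNext d x w b := by exact_mod_cast h
        exact div_pos this hN
      rw [hrN b, mul_assoc, mul_assoc, ← mul_sub, ← mul_sub]
      refine mul_le_mul_of_nonneg_left ?_ hN.le
      have h3 : Real.log (√(p b) / √(r b)) ≤ √(p b) / √(r b) - 1 :=
        Real.log_le_sub_one_of_pos (by positivity)
      rw [Real.log_div (by positivity) (by positivity), Real.log_sqrt hpb.le,
        Real.log_sqrt hrb.le] at h3
      have h4 : r b * (√(p b) / √(r b)) = √(r b) * √(p b) := by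
        have h1 := Real.mul_self_sqrt hrb.le
        have h5 : √(r b) ≠ 0 := by positivity
        field_simp
        rw [sq, h1]
      nlinarith [mul_le_mul_of_nonneg_left h3 hrb.le]
  have hsum : logLik d x w - ∑ b, (countNext d x w b : ℝ) * Real.log (p b) =
      ∑ b, ((countNext d x w b : ℝ) * Real.log (r b) -
        (countNext d x w b : ℝ) * Real.log (p b)) := by
    rw [logLik, Finset.sum_sub_distrib]
  have hr_le : ∀ b, r b ≤ 1 := fun b =>
    hr1 ▸ Finset.single_le_sum (fun c _ => hr0 c) (Finset.mem_univ b)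
  have hp_le : ∀ b, p b ≤ 1 := fun b =>
    hp1 ▸ Finset.single_le_sum (fun c _ => hp c) (Finset.mem_univ b)
  have hsq : (r a - p a) ^ 2 / 4 ≤ (√(r a) - √(p a)) ^ 2 := by
    have h1 := Real.mul_self_sqrt (hr0 a)
    have h2 := Real.mul_self_sqrt (hp a)
    have h3 : √(r a) ≤ 1 := Real.sqrt_le_one.2 (hr_le a)
    have h4 : √(p a) ≤ 1 := Real.sqrt_le_one.2 (hp_le a)
    have h5 : r a - p a = (√(r a) - √(p a)) * (√(r a) + √(p a)) := by
      linear_combination -h1 + h2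
    have h6 : (√(r a) + √(p a)) ^ 2 ≤ 2 ^ 2 :=
      pow_le_pow_left₀ (by positivity) (by linarith) 2
    rw [h5, mul_pow]
    nlinarith [sq_nonneg (√(r a) - √(p a))]
  calc N * (r a - p a) ^ 2 / 4 = N * ((r a - p a) ^ 2 / 4) := by ring
    _ ≤ N * (√(r a) - √(p a)) ^ 2 := mul_le_mul_of_nonneg_left hsq hN.le
    _ ≤ N * ∑ b, (√(r b) - √(p b)) ^ 2 := by
        refine mul_le_mul_of_nonneg_left ?_ hN.le
        exact Finset.single_le_sum (f := fun b => (√(r b) - √(p b)) ^ 2)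
          (fun b _ => sq_nonneg _) (Finset.mem_univ a)
    _ = ∑ b, N * ((√(r b) - √(p b)) ^ 2 + r b - p b) := by
        rw [← Finset.mul_sum, Finset.sum_sub_distrib, Finset.sum_add_distrib, hr1, hp1]
        ring
    _ ≤ _ := by
        rw [hsum]
        exact Finset.sum_le_sum fun b _ => hterm b

/-- The Gibbs inequality for the empirical distribution after `w`. -/
theorem sum_mul_log_le_logLik (d : ℕ) (x w : List A) (p : A → ℝ) (hp : ∀ a, 0 ≤ p a)
    (hp1 : ∑ a, p a = 1) (hpos : ∀ a, 0 < countNext d x w a → 0 < p a)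
    (hw : 1 ≤ count d x w) :
    ∑ b, (countNext d x w b : ℝ) * Real.log (p b) ≤ logLik d x w := by
  obtain ⟨a, -, -⟩ : ∃ a ∈ (Finset.univ : Finset A), p a ≠ 0 :=
    Finset.exists_ne_zero_of_sum_ne_zero (by rw [hp1]; exact one_ne_zero)
  have h := sq_le_logLik_sub d x w p hp hp1 hpos hw a
  have : 0 ≤ (count d x w : ℝ) * ((countNext d x w a : ℝ) / count d x w - p a) ^ 2 / 4 := by
    positivity
  linarith

end Likelihood

/-! ### Finite sets of strings of bounded length. -/

section Words

variable {A : Type*} [Fintype A] [DecidableEq A]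

/-- The finite set of strings of length `k`. -/
def words (A : Type*) [Fintype A] [DecidableEq A] (k : ℕ) : Finset (List A) :=
  (Finset.univ : Finset (Fin k → A)).image List.ofFn

theorem mem_words {k : ℕ} {w : List A} : w ∈ words A k ↔ w.length = k := by
  constructor
  · intro h
    obtain ⟨f, -, rfl⟩ := Finset.mem_image.1 h
    simp
  · rintro rfl
    exact Finset.mem_image.2 ⟨w.get, Finset.mem_univ _, List.ofFn_get w⟩

theorem card_words (k : ℕ) : (words A k).card = Fintype.card A ^ k := by
  rw [words, Finset.card_image_of_injective _ List.ofFn_injective, Finset.card_univ]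
  simp

/-- The strings of length at most `d`. -/
def wordsLE (A : Type*) [Fintype A] [DecidableEq A] (d : ℕ) : Finset (List A) :=
  (Finset.range (d + 1)).biUnion (words A)

theorem mem_wordsLE {d : ℕ} {w : List A} : w ∈ wordsLE A d ↔ w.length ≤ d := by
  simp [wordsLE, mem_words]

theorem card_wordsLE_le [Nontrivial A] (d : ℕ) :
    (wordsLE A d).card ≤ 2 * Fintype.card A ^ d := by
  have h2 : 2 ≤ Fintype.card A := Fintype.one_lt_card
  refine Finset.card_biUnion_le.trans ?_
  simp only [card_words]
  induction d with
  | zero => simp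
  | succ d ih =>
    rw [Finset.sum_range_succ, pow_succ]
    nlinarith [Nat.mul_le_mul_left (Fintype.card A ^ d) h2]

/-- The strings of length `k` that end in `w`. -/
def extensions (w : List A) (k : ℕ) : Finset (List A) := (words A k).filter (w <:+ ·)

theorem mem_extensions {w u : List A} {k : ℕ} :
    u ∈ extensions w k ↔ u.length = k ∧ w <:+ u := by
  simp [extensions, mem_words]

theorem indicator_eq_sum_extensions {w : List A} {k : ℕ} (hk : w.length ≤ k) (y : List A)
    (hy : k ≤ y.length) :
    (if w <:+ y then 1 else 0) = ∑ u ∈ extensions w k, if u <:+ y then 1 else 0 := by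
  have hdl : (y.drop (y.length - k)).length = k := by simp; omega
  split_ifs with h
  · rw [Finset.sum_eq_single (y.drop (y.length - k))]
    · rw [if_pos (List.drop_suffix _ _)]
    · intro u hu hne
      refine if_neg fun huy => hne ?_
      have hl := (mem_extensions.1 hu).1
      exact (List.suffix_of_suffix_length_le huy (List.drop_suffix _ _)
        (by omega)).eq_of_length (by omega)
    · intro hn
      exact absurd (mem_extensions.2 ⟨hdl, List.suffix_of_suffix_length_le h
        (List.drop_suffix _ _) (by omega)⟩) hn
  · refine (Finset.sum_eq_zero fun u hu => if_neg fun huy => h ?_).symm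
    exact (mem_extensions.1 hu).2.trans huy

end Words

/-! ### Pruning and refining feasible trees. -/

section Surgery

variable {A : Type*} [Fintype A] [DecidableEq A] {d : ℕ} {x : List A} {τ : Finset (List A)}

theorem IsFeasible.eq_of_suffix (h : IsFeasible d x τ) {s w : List A} (hs : s ∈ τ) (hw : w ∈ τ)
    (hsw : s <:+ w) : s = w :=
  isTree_asTree_iff.1 h.isTree s hs w hw hsw

theorem IsFeasible.length_le (h : IsFeasible d x τ) {w : List A} (hw : w ∈ τ) : w.length ≤ d :=
  height_asTree_le_iff.1 h.height_le w hw

theorem IsFeasible.exists_endsIn (h : IsFeasible d x τ) (z : ℕ → A) : ∃ s ∈ τ, EndsIn z s :=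
  isComplete_asTree_iff.1 h.isComplete z

theorem IsFeasible.exists_comparable [Nonempty A] (h : IsFeasible d x τ) (y : List A) :
    ∃ s ∈ τ, s <:+ y ∨ y <:+ s := by
  obtain ⟨z, hz⟩ := PLTree.exists_endsIn y
  obtain ⟨s, hs, hzs⟩ := h.exists_endsIn z
  exact ⟨s, hs, hzs.comparable hz⟩

theorem IsFeasible.exists_suffix [Nonempty A] (h : IsFeasible d x τ) {y : List A}
    (hy : d ≤ y.length) : ∃ s ∈ τ, s <:+ y := by
  obtain ⟨s, hs, h1 | h1⟩ := h.exists_comparable y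
  · exact ⟨s, hs, h1⟩
  · refine ⟨s, hs, ?_⟩
    rw [h1.eq_of_length_le ((h.length_le hs).trans hy)]

theorem IsFeasible.not_suffix_of_inner (h : IsFeasible d x τ) {s v w : List A} (hs : s ∈ τ)
    (hw : w ∈ τ) (hv : v <:+ w) (hne : v ≠ w) : ¬ s <:+ v := by
  intro hsv
  have := h.eq_of_suffix hs hw (hsv.trans hv)
  subst this
  exact hne (hv.eq_of_length_le hsv.length_le)

/-- Replacing all leaves above an inner node `v` by the leaf `v` keeps a tree feasible. -/
theorem IsFeasible.prune (h : IsFeasible d x τ) {v w : List A} (hw : w ∈ τ) (hv : v <:+ w)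
    (hne : v ≠ w) : IsFeasible d x (insert v (τ.filter fun u => ¬ v <:+ u)) := by
  refine ⟨isTree_asTree_iff.2 ?_, isComplete_asTree_iff.2 ?_, height_asTree_le_iff.2 ?_, ?_, ?_⟩
  · intro s hs u hu hsu
    rcases Finset.mem_insert.1 hs with rfl | hs <;> rcases Finset.mem_insert.1 hu with rfl | hu
    · rfl
    · exact absurd hsu (Finset.mem_filter.1 hu).2
    · exact absurd hsu (h.not_suffix_of_inner (Finset.mem_filter.1 hs).1 hw hv hne)
    · exact h.eq_of_suffix (Finset.mem_filter.1 hs).1 (Finset.mem_filter.1 hu).1 hsu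
  · intro z
    obtain ⟨s, hs, hz⟩ := h.exists_endsIn z
    by_cases hvs : v <:+ s
    · exact ⟨v, Finset.mem_insert_self _ _, hz.of_suffix hvs⟩
    · exact ⟨s, Finset.mem_insert_of_mem (Finset.mem_filter.2 ⟨hs, hvs⟩), hz⟩
  · intro s hs
    rcases Finset.mem_insert.1 hs with rfl | hs
    · exact hv.length_le.trans (h.length_le hw)
    · exact h.length_le (Finset.mem_filter.1 hs).1
  · intro s hs
    rcases Finset.mem_insert.1 hs with rfl | hs
    · exact (h.occurs w hw).trans (count_anti d x hv)
    · exact h.occurs s (Finset.mem_filter.1 hs).1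
  · have key : ∀ w' s : List A, s ∈ τ → (w' <:+ s ∨ s <:+ w') →
        ∃ u ∈ insert v (τ.filter fun u => ¬ v <:+ u), w' <:+ u ∨ u <:+ w' := by
      intro w' s hs hc
      by_cases hvs : v <:+ s
      · refine ⟨v, Finset.mem_insert_self _ _, ?_⟩
        rcases hc with hc | hc
        · exact suffix_comparable hc hvs
        · exact Or.inr (hvs.trans hc)
      · exact ⟨s, Finset.mem_insert_of_mem (Finset.mem_filter.2 ⟨hs, hvs⟩), hc⟩
    intro w' hl hc
    obtain ⟨u, hu, huw⟩ : ∃ u ∈ insert v (τ.filter fun u => ¬ v <:+ u),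
        w' <:+ u ∨ u <:+ w' := by
      rcases h.covers w' hl hc with h1 | ⟨s, hs, h1⟩ | ⟨s, hs, h1⟩
      · exact key w' w' h1 (Or.inl (List.suffix_refl _))
      · exact key w' s hs (Or.inl (properSuffix_inl_iff.1 h1).1)
      · exact key w' s hs (Or.inr (properSuffix_inl_iff.1 h1).1)
    by_cases he : w' = u
    · exact Or.inl (he ▸ hu)
    · rcases huw with h1 | h1
      · exact Or.inr (Or.inl ⟨u, hu, properSuffix_inl_iff.2 ⟨h1, he⟩⟩)
      · exact Or.inr (Or.inr ⟨u, hu, properSuffix_inl_iff.2 ⟨h1, Ne.symm he⟩⟩)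

/-- Replacing a leaf `w` by all its extensions of length `k` keeps a tree feasible if these
extensions occur in the sample. -/
theorem IsFeasible.refine_leaf [Nonempty A] (h : IsFeasible d x τ) {w : List A} (hw : w ∈ τ)
    {k : ℕ} (hwk : w.length ≤ k) (hk : k ≤ d) (hocc : ∀ u ∈ extensions w k, 1 ≤ count d x u) :
    IsFeasible d x (τ.erase w ∪ extensions w k) := by
  have hex : ∀ z : List A, w <:+ z → ∃ u ∈ extensions w k, z <:+ u ∨ u <:+ z := by
    intro z hz
    obtain ⟨y, hy⟩ := PLTree.exists_endsIn z
    exact ⟨lastSymbols y k, mem_extensions.2 ⟨lastSymbols_length _ _,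
      (hy.of_suffix hz).suffix_lastSymbols hwk⟩, hy.comparable (endsIn_lastSymbols y k)⟩
  refine ⟨isTree_asTree_iff.2 ?_, isComplete_asTree_iff.2 ?_, height_asTree_le_iff.2 ?_, ?_, ?_⟩
  · intro s hs u hu hsu
    rcases Finset.mem_union.1 hs with hs | hs <;> rcases Finset.mem_union.1 hu with hu | hu
    · exact h.eq_of_suffix (Finset.mem_of_mem_erase hs) (Finset.mem_of_mem_erase hu) hsu
    · have hsτ := Finset.mem_of_mem_erase hs
      have hsw := Finset.ne_of_mem_erase hs
      rcases suffix_comparable hsu (mem_extensions.1 hu).2 with h1 | h1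
      · exact absurd (h.eq_of_suffix hsτ hw h1) hsw
      · exact absurd (h.eq_of_suffix hw hsτ h1).symm hsw
    · have huτ := Finset.mem_of_mem_erase hu
      exact absurd (h.eq_of_suffix hw huτ ((mem_extensions.1 hs).2.trans hsu)).symm
        (Finset.ne_of_mem_erase hu)
    · exact hsu.eq_of_length ((mem_extensions.1 hs).1.trans (mem_extensions.1 hu).1.symm)
  · intro z
    obtain ⟨s, hs, hz⟩ := h.exists_endsIn z
    by_cases hsw : s = w
    · subst hsw
      exact ⟨lastSymbols z k, Finset.mem_union_right _ (mem_extensions.2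
        ⟨lastSymbols_length _ _, hz.suffix_lastSymbols hwk⟩), endsIn_lastSymbols z k⟩
    · exact ⟨s, Finset.mem_union_left _ (Finset.mem_erase.2 ⟨hsw, hs⟩), hz⟩
  · intro s hs
    rcases Finset.mem_union.1 hs with hs | hs
    · exact h.length_le (Finset.mem_of_mem_erase hs)
    · exact (mem_extensions.1 hs).1.trans_le hk
  · intro s hs
    rcases Finset.mem_union.1 hs with hs | hs
    · exact h.occurs s (Finset.mem_of_mem_erase hs)
    · exact hocc s hs
  · have key : ∀ w' s : List A, s ∈ τ → (w' <:+ s ∨ s <:+ w') →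
        ∃ u ∈ τ.erase w ∪ extensions w k, w' <:+ u ∨ u <:+ w' := by
      intro w' s hs hc
      by_cases hsw : s = w
      · subst hsw
        rcases hc with hc | hc
        · obtain ⟨u, hu, -⟩ := hex s (List.suffix_refl _)
          exact ⟨u, Finset.mem_union_right _ hu, Or.inl (hc.trans (mem_extensions.1 hu).2)⟩
        · obtain ⟨u, hu, hu'⟩ := hex w' hc
          exact ⟨u, Finset.mem_union_right _ hu, hu'⟩
      · exact ⟨s, Finset.mem_union_left _ (Finset.mem_erase.2 ⟨hsw, hs⟩), hc⟩
    intro w' hl hc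
    obtain ⟨u, hu, huw⟩ : ∃ u ∈ τ.erase w ∪ extensions w k, w' <:+ u ∨ u <:+ w' := by
      rcases h.covers w' hl hc with h1 | ⟨s, hs, h1⟩ | ⟨s, hs, h1⟩
      · exact key w' w' h1 (Or.inl (List.suffix_refl _))
      · exact key w' s hs (Or.inl (properSuffix_inl_iff.1 h1).1)
      · exact key w' s hs (Or.inr (properSuffix_inl_iff.1 h1).1)
    by_cases he : w' = u
    · exact Or.inl (he ▸ hu)
    · rcases huw with h1 | h1
      · exact Or.inr (Or.inl ⟨u, hu, properSuffix_inl_iff.2 ⟨h1, he⟩⟩)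
      · exact Or.inr (Or.inr ⟨u, hu, properSuffix_inl_iff.2 ⟨h1, Ne.symm he⟩⟩)

/-- A history of length at least `d` ends in exactly one leaf. If it also ends in the inner node
`v`, that leaf is above `v`, since no leaf is a suffix of `v`. -/
theorem IsFeasible.indicator_eq_sum [Nonempty A] (h : IsFeasible d x τ) {v w : List A}
    (hw : w ∈ τ) (hv : v <:+ w) (hne : v ≠ w) (y : List A) (hy : d ≤ y.length) :
    (if v <:+ y then 1 else 0) =
      ∑ u ∈ τ.filter (fun u => v <:+ u), if u <:+ y then 1 else 0 := by
  split_ifs with hvy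
  · obtain ⟨s, hs, hsy⟩ := h.exists_suffix hy
    have hvs : v <:+ s := (suffix_comparable hvy hsy).resolve_right
      (h.not_suffix_of_inner hs hw hv hne)
    rw [Finset.sum_eq_single s, if_pos hsy]
    · intro u hu hus
      refine if_neg fun huy => hus ?_
      have huτ := (Finset.mem_filter.1 hu).1
      rcases suffix_comparable huy hsy with h1 | h1
      · exact h.eq_of_suffix huτ hs h1
      · exact (h.eq_of_suffix hs huτ h1).symm
    · exact fun hn => absurd (Finset.mem_filter.2 ⟨hs, hvs⟩) hn
  · refine (Finset.sum_eq_zero fun u hu => if_neg fun huy => hvy ?_).symm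
    exact (Finset.mem_filter.1 hu).2.trans huy

/-- The leaf `w` reaches `v` through some letter `b`. For another letter `c`, completeness gives a
leaf comparable with `c :: v`; it cannot be a suffix of `v`, so it lies above `c :: v`. -/
theorem IsFeasible.one_lt_card_above [Nontrivial A] (h : IsFeasible d x τ) {v w : List A}
    (hw : w ∈ τ) (hv : v <:+ w) (hne : v ≠ w) :
    1 < (τ.filter fun u => v <:+ u).card := by
  obtain ⟨z, rfl⟩ := hv
  obtain ⟨z', b, rfl⟩ : ∃ z' b, z = z' ++ [b] :=
    ⟨_, _, (List.dropLast_append_getLast (by rintro rfl; simp at hne : z ≠ [])).symm⟩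
  obtain ⟨c, hc⟩ := exists_ne b
  have hv : v <:+ z' ++ [b] ++ v := List.suffix_append _ _
  obtain ⟨s, hs, hcomp⟩ := h.exists_comparable (c :: v)
  have hcs : c :: v <:+ s := by
    rcases hcomp with h1 | h1
    · rcases List.suffix_cons_iff.1 h1 with h2 | h2
      · rw [h2]
      · exact absurd h2 (h.not_suffix_of_inner hs hw hv hne)
    · exact h1
  refine Finset.one_lt_card.2 ⟨s, Finset.mem_filter.2 ⟨hs, (List.suffix_cons _ _).trans hcs⟩,
    _, Finset.mem_filter.2 ⟨hw, hv⟩, ?_⟩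
  rintro rfl
  have h3 : b :: v <:+ z' ++ [b] ++ v := ⟨z', by simp⟩
  have := (List.suffix_of_suffix_length_le hcs h3 (by simp)).eq_of_length (by simp)
  exact hc (List.cons.inj this).1

/-- If an optimal tree has a leaf above `v`, then at some leaf `u` above `v` the empirical
distribution is far from any given distribution `p`. -/
theorem IsFeasible.exists_far_leaf [Nontrivial A] (h : IsFeasible d x τ) {c : ℝ} (hc : 0 < c)
    (hmin : ∀ τ', IsFeasible d x τ' → penCost d c x τ ≤ penCost d c x τ') {v w : List A}
    (hw : w ∈ τ) (hv : v <:+ w) (hne : v ≠ w) (p : A → ℝ) (hp : ∀ a, 0 < p a)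
    (hp1 : ∑ a, p a = 1) :
    ∃ u ∈ τ, v <:+ u ∧
      c / 2 ≤ logLik d x u - ∑ a, (countNext d x u a : ℝ) * Real.log (p a) := by
  by_contra! hcon
  have hcost := hmin _ (h.prune hw hv hne)
  have hvR : v ∉ τ.filter fun u => ¬ v <:+ u := fun hm =>
    (Finset.mem_filter.1 hm).2 (List.suffix_refl _)
  rw [penCost_eq, penCost_eq, Finset.sum_insert hvR, Finset.card_insert_of_notMem hvR,
    ← Finset.sum_filter_add_sum_filter_not τ (fun u => v <:+ u),
    ← Finset.card_filter_add_card_filter_not (s := τ) (fun u => v <:+ u)] at hcost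
  push_cast at hcost
  -- With `M ≥ 2` leaves above `v`, pruning saves `(M - 1) c ≥ M c / 2`, so the excess per leaf
  -- averages at least `c / 2`.
  have hcard : (2 : ℝ) ≤ ((τ.filter fun u => v <:+ u).card : ℝ) := by
    exact_mod_cast h.one_lt_card_above hw hv hne
  have hgibbs := sum_mul_log_le_logLik d x v p (fun a => (hp a).le) hp1 (fun a _ => hp a)
    ((h.occurs w hw).trans (count_anti d x hv))
  have hsplit : ∑ a, (countNext d x v a : ℝ) * Real.log (p a) =
      ∑ u ∈ τ.filter (fun u => v <:+ u), ∑ a, (countNext d x u a : ℝ) * Real.log (p a) := by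
    rw [Finset.sum_comm]
    refine Finset.sum_congr rfl fun a _ => ?_
    rw [countNext_eq_sum d x v _ (h.indicator_eq_sum hw hv hne) a, Nat.cast_sum, Finset.sum_mul]
  have hlt : ∑ u ∈ τ.filter (fun u => v <:+ u),
      (logLik d x u - ∑ a, (countNext d x u a : ℝ) * Real.log (p a)) <
      ∑ u ∈ τ.filter (fun u => v <:+ u), c / 2 :=
    Finset.sum_lt_sum_of_nonempty ⟨w, Finset.mem_filter.2 ⟨hw, hv⟩⟩ fun u hu =>
      hcon u (Finset.mem_filter.1 hu).1 (Finset.mem_filter.1 hu).2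
  rw [Finset.sum_const, nsmul_eq_mul, Finset.sum_sub_distrib, ← hsplit] at hlt
  nlinarith

/-- The likelihood gained by refining a leaf of an optimal tree is at most the penalty. -/
theorem IsFeasible.gain_le [Nonempty A] (h : IsFeasible d x τ) {c : ℝ} (hc : 0 < c)
    (hmin : ∀ τ', IsFeasible d x τ' → penCost d c x τ ≤ penCost d c x τ') {w : List A}
    (hw : w ∈ τ) {k : ℕ} (hwk : w.length ≤ k) (hk : k ≤ d)
    (hocc : ∀ u ∈ extensions w k, 1 ≤ count d x u) :
    ∑ u ∈ extensions w k, logLik d x u - logLik d x w ≤ (Fintype.card A : ℝ) ^ k * c := by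
  have hcost := hmin _ (h.refine_leaf hw hwk hk hocc)
  have hdisj : Disjoint (τ.erase w) (extensions w k) := by
    rw [Finset.disjoint_left]
    intro u hu hu'
    exact Finset.ne_of_mem_erase hu (h.eq_of_suffix hw (Finset.mem_of_mem_erase hu)
      (mem_extensions.1 hu').2).symm
  rw [penCost_eq, penCost_eq, Finset.sum_union hdisj, Finset.card_union_of_disjoint hdisj,
    ← Finset.add_sum_erase τ _ hw, ← Finset.card_erase_add_one hw] at hcost
  have hcard : ((extensions w k).card : ℝ) ≤ (Fintype.card A : ℝ) ^ k := by
    have := (Finset.card_filter_le (words A k) (w <:+ ·)).trans_eq (card_words k)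
    exact_mod_cast this
  push_cast at hcost
  nlinarith

/-- The likelihood gained by refining a leaf is at least proportional to the counts of two
extensions with separated empirical distributions. -/
theorem le_gain {w u₁ u₂ : List A} {k : ℕ} (hwk : w.length ≤ k) (hk : k ≤ d)
    (hocc : ∀ u ∈ extensions w k, 1 ≤ count d x u) (hu₁ : u₁ ∈ extensions w k)
    (hu₂ : u₂ ∈ extensions w k) (a : A) {s η : ℝ} (hs : 0 ≤ s) (hη : 0 < η)
    (hs₁ : s ≤ count d x u₁) (hs₂ : s ≤ count d x u₂)
    (hsep : (countNext d x u₁ a : ℝ) / count d x u₁ + η ≤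
      (countNext d x u₂ a : ℝ) / count d x u₂) :
    s * η ^ 2 / 8 ≤ ∑ u ∈ extensions w k, logLik d x u - logLik d x w := by
  -- With the empirical law after `w` as reference, the gain becomes a sum of nonnegative
  -- divergences over the extensions, of which only `u₁` and `u₂` are kept.
  set p : A → ℝ := fun b => (countNext d x w b : ℝ) / count d x w with hpdef
  have hwc : 1 ≤ count d x w := (hocc u₁ hu₁).trans (count_anti d x (mem_extensions.1 hu₁).2)
  have hwc' : (0 : ℝ) < count d x w := by exact_mod_cast hwc
  have hp : ∀ b, 0 ≤ p b := fun b => by positivity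
  have hp1 : ∑ b, p b = 1 := by
    simp only [hpdef]
    rw [← Finset.sum_div, ← cast_count, div_self hwc'.ne']
  have hpos : ∀ u ∈ extensions w k, ∀ b, 0 < countNext d x u b → 0 < p b := by
    intro u hu b hb
    have : 0 < countNext d x w b := hb.trans_le (countNext_anti d x (mem_extensions.1 hu).2 b)
    positivity
  have hsplit : logLik d x w =
      ∑ u ∈ extensions w k, ∑ b, (countNext d x u b : ℝ) * Real.log (p b) := by
    rw [Finset.sum_comm, logLik]
    refine Finset.sum_congr rfl fun b _ => ?_
    rw [countNext_eq_sum d x w _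
      (fun y hy => indicator_eq_sum_extensions hwk y (hk.trans hy)) b,
      Nat.cast_sum, Finset.sum_mul]
    refine Finset.sum_congr rfl fun u _ => ?_
    simp only [hpdef]
    rw [countNext_eq_sum d x w _
      (fun y hy => indicator_eq_sum_extensions hwk y (hk.trans hy)) b, Nat.cast_sum]
  have hne : u₁ ≠ u₂ := by
    rintro rfl
    linarith
  rw [hsplit, ← Finset.sum_sub_distrib]
  set F : List A → ℝ := fun u =>
    logLik d x u - ∑ b, (countNext d x u b : ℝ) * Real.log (p b) with hF
  have hF0 : ∀ u ∈ extensions w k, 0 ≤ F u := fun u hu =>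
    sub_nonneg.2 (sum_mul_log_le_logLik d x u p hp hp1 (hpos u hu) (hocc u hu))
  have hFle : ∀ u ∈ extensions w k, s ≤ count d x u →
      s * ((countNext d x u a : ℝ) / count d x u - p a) ^ 2 / 4 ≤ F u := by
    intro u hu hsu
    refine le_trans ?_ (sq_le_logLik_sub d x u p hp hp1 (hpos u hu) (hocc u hu) a)
    gcongr
  have h1 := hFle u₁ hu₁ hs₁
  have h2 := hFle u₂ hu₂ hs₂
  have h3 : F u₁ + F u₂ ≤ ∑ u ∈ extensions w k, F u := by
    rw [← Finset.sum_pair hne]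
    refine Finset.sum_le_sum_of_subset_of_nonneg ?_ fun u hu _ => hF0 u hu
    intro u hu
    rcases Finset.mem_insert.1 hu with rfl | hu
    · exact hu₁
    · rw [Finset.mem_singleton.1 hu]; exact hu₂
  set r₁ := (countNext d x u₁ a : ℝ) / count d x u₁
  set r₂ := (countNext d x u₂ a : ℝ) / count d x u₂
  -- Whatever the value `p a`, it cannot be close to both separated frequencies.
  have h4 : η ^ 2 ≤ 2 * ((r₁ - p a) ^ 2 + (r₂ - p a) ^ 2) := by
    have h5 : η ^ 2 ≤ (r₂ - r₁) ^ 2 := pow_le_pow_left₀ hη.le (by linarith) 2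
    nlinarith [sq_nonneg (r₁ - p a + (r₂ - p a))]
  have h6 := mul_le_mul_of_nonneg_left h4 hs
  linarith

end Surgery

/-! ### The sample as a word, and shifts of the process. -/

section Sample

variable {Ω A : Type*}

theorem sample_length (X : ℤ → Ω → A) (n : ℕ) (ω : Ω) : (sample X n ω).length = n := by
  simp [sample]

theorem sample_succ (X : ℤ → Ω → A) (n : ℕ) (ω : Ω) :
    sample X (n + 1) ω = sample X n ω ++ [X ((n : ℤ) + 1) ω] := by
  rw [sample, List.ofFn_succ_last]
  simp [sample]

theorem sample_eq_concat_iff (X : ℤ → Ω → A) (h : List A) (a : A) (ω : Ω) :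
    sample X (h ++ [a]).length ω = h ++ [a] ↔
      sample X h.length ω = h ∧ X ((h.length : ℤ) + 1) ω = a := by
  rw [List.length_append, List.length_singleton, sample_succ]
  constructor
  · intro H
    have := List.append_inj' H rfl
    exact ⟨this.1, by simpa using this.2⟩
  · rintro ⟨h1, h2⟩
    rw [h1, h2]

theorem lastSymbols_past (X : ℤ → Ω → A) (k : ℕ) (ω : Ω) :
    lastSymbols (past X ω) k = List.ofFn fun i : Fin k => X ((i : ℤ) - k) ω := by
  refine List.ext_getElem (by simp [lastSymbols]) fun i h1 h2 => ?_
  have hi : i < k := by simpa [lastSymbols] using h1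
  simp only [lastSymbols, past, List.getElem_reverse, List.getElem_ofFn, List.length_ofFn]
  congr 2
  omega

theorem shift_iterate (k : ℕ) (z : ℤ → A) :
    (fun (x : ℤ → A) (t : ℤ) => x (t + 1))^[k] z = fun t => z (t + k) := by
  induction k generalizing z with
  | zero => simp
  | succ k ih =>
    rw [Function.iterate_succ_apply, ih]
    funext t
    congr 1
    push_cast
    ring

end Sample

/-! ### Probabilities of finite words. -/

section Chains

variable {Ω A : Type*} [MeasurableSpace Ω]

/-- The probability that the process starts with the string `h` at time `1`. -/
noncomputable def wordProb (P : Measure Ω) (X : ℤ → Ω → A) (h : List A) : ℝ :=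
  P.real {ω | sample X h.length ω = h}

theorem wordProb_nonneg (P : Measure Ω) (X : ℤ → Ω → A) (h : List A) : 0 ≤ wordProb P X h :=
  measureReal_nonneg

theorem wordProb_nil (P : Measure Ω) [IsProbabilityMeasure P] (X : ℤ → Ω → A) :
    wordProb P X [] = 1 := by
  simp [wordProb, sample]

variable [MeasurableSpace A]

/-! ### Context tree and oscillation of the transition probabilities. -/

section Contexts

variable {P : Measure Ω} {X : ℤ → Ω → A} {q : Kernel (ℕ → A) A}

theorem IsTransitionVersion.integrable (hq : IsTransitionVersion P X q) (a : A) :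
    Integrable (fun ω => (q (past X ω)).real {a}) P :=
  integrable_condExp.congr (hq a)

theorem condProb_nonneg (w : Str A) (a : A) : 0 ≤ condProb P X q w a := by
  cases w <;> exact measureReal_nonneg

theorem bddBelow_condProb {ι : Type*} (w : ι → Str A) (a : ι → A) :
    BddBelow (Set.range fun i => condProb P X q (w i) (a i)) :=
  ⟨0, by rintro _ ⟨i, rfl⟩; exact condProb_nonneg _ _⟩

/-- Every semi-infinite sequence ends in an element of the context tree with the same
transition probabilities. -/
theorem exists_context_of_seq (x : ℕ → A) (u : List A) (hu : EndsIn x u) :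
    ∃ w ∈ contextTree P X q, (ProperSuffix u w ∨ SuffixEq w (Sum.inl u)) ∧
      ∀ a, condProb P X q w a = (q x).real {a} := by
  by_cases h : IsInfContext P X q x
  · exact ⟨Sum.inr x, h, Or.inl hu, fun a => rfl⟩
  · simp only [IsInfContext, not_forall, not_not] at h
    obtain ⟨k, hk⟩ := h
    refine ⟨Sum.inl (lastSymbols x k), hk, ?_, fun a => (hk.1 x (endsIn_lastSymbols x k) a).symm⟩
    rw [suffixEq_inl_inl, properSuffix_inl_iff]
    rcases hu.comparable (endsIn_lastSymbols x k) with h1 | h1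
    · by_cases h2 : u = lastSymbols x k
      · right; rw [← h2]
      · exact Or.inl ⟨h1, h2⟩
    · exact Or.inr h1

theorem Determines.exists_isContext {w : List A} (h : Determines P X q w) :
    ∃ s, s <:+ w ∧ IsContext P X q s := by
  induction hn : w.length using Nat.strong_induction_on generalizing w with
  | _ n ih =>
    by_cases hc : IsContext P X q w
    · exact ⟨w, List.suffix_refl _, hc⟩
    · simp only [IsContext, h, true_and, not_forall, not_not] at hc
      obtain ⟨s, hs, hds⟩ := hc
      obtain ⟨h1, h2⟩ := properSuffix_inl_iff.1 hs
      have hl : s.length < n := hn ▸ lt_of_le_of_ne h1.length_le fun he => h2 (h1.eq_of_length he)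
      obtain ⟨t, ht, htc⟩ := ih _ hl hds rfl
      exact ⟨t, ht.trans h1, htc⟩

/-- For finite `u` this is minimality of contexts. For infinite `u`, a determining suffix would have
a shortest determining suffix, which is a context. -/
theorem not_determines_of_properSuffix {w : List A} {u : Str A} (hu : u ∈ contextTree P X q)
    (hw : ProperSuffix w u) : ¬ Determines P X q w := by
  intro hd
  cases u with
  | inl u => exact (show IsContext P X q u from hu).2 w hw hd
  | inr x =>
    obtain ⟨s, hs, hsc⟩ := hd.exists_isContext
    have hxs : EndsIn x s := EndsIn.of_suffix hw hs
    refine (show IsInfContext P X q x from hu) s.length ?_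
    rwa [show lastSymbols x s.length = s from hxs]

theorem of_mem_interior_trunc {w : List A} {K : ℕ}
    (hw : w ∈ interior (trunc (contextTree P X q) K)) :
    w.length < K ∧ ¬ Determines P X q w := by
  obtain ⟨u, hu | ⟨s, rfl, hsK, v, hv, hsv⟩, hwu⟩ := hw
  · refine ⟨?_, not_determines_of_properSuffix hu.1 hwu⟩
    cases u with
    | inl u =>
      obtain ⟨h1, h2⟩ := properSuffix_inl_iff.1 hwu
      have h3 : u.length ≤ K := ENat.natCast_le_natCast.1 hu.2
      exact (lt_of_le_of_ne h1.length_le fun he => h2 (h1.eq_of_length he)).trans_le h3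
    | inr x => exact absurd hu.2 (by simp [len])
  · obtain ⟨h1, h2⟩ := properSuffix_inl_iff.1 hwu
    refine ⟨hsK ▸ lt_of_le_of_ne h1.length_le fun he => h2 (h1.eq_of_length he), ?_⟩
    refine not_determines_of_properSuffix hv ?_
    cases v with
    | inl v =>
      obtain ⟨h3, h4⟩ := properSuffix_inl_iff.1 hsv
      refine properSuffix_inl_iff.2 ⟨h1.trans h3, ?_⟩
      rintro rfl
      exact h4 (h3.eq_of_length_le h1.length_le)
    | inr x => exact EndsIn.of_suffix hsv h1

variable [Fintype A]

theorem sum_kernel_real [MeasurableSingletonClass A] (q : Kernel (ℕ → A) A) [IsMarkovKernel q] (x : ℕ → A) :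
    ∑ a, (q x).real {a} = 1 := by
  rw [sum_measureReal_singleton]
  simp

theorem alpha_zero_le (x : ℕ → A) (a : A) : alpha P X q 0 ≤ (q x).real {a} := by
  obtain ⟨w, hw, -, h⟩ := exists_context_of_seq (P := P) (X := X) (q := q) x [] rfl
  rw [← h a]
  exact ciInf_le (bddBelow_condProb (fun wa : {w : Str A // w ∈ contextTree P X q} × A => wa.1.1)
    fun wa => wa.2) (⟨w, hw⟩, a)

/-- On the sequences that end in a given string of length `k` the transition probabilities
oscillate by at most `1 - α_k`. -/
theorem kernel_real_sub_le [MeasurableSingletonClass A] [IsMarkovKernel q] {k : ℕ} {u : List A} (hk : u.length = k + 1)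
    {x y : ℕ → A} (hx : EndsIn x u) (hy : EndsIn y u) (a : A) :
    (q x).real {a} - (q y).real {a} ≤ 1 - alpha P X q (k + 1) := by
  classical
  set g : A → ℝ := fun b => ⨅ w : {w : Str A // w ∈ contextTree P X q ∧
    (ProperSuffix u w ∨ SuffixEq w (Sum.inl u))}, condProb P X q w.1 b with hg
  have hle : ∀ z, EndsIn z u → ∀ b, g b ≤ (q z).real {b} := by
    intro z hz b
    obtain ⟨w, hw, hwu, h⟩ := exists_context_of_seq (P := P) (X := X) (q := q) z u hz
    rw [← h b]
    exact ciInf_le (bddBelow_condProb (fun w : {w : Str A // w ∈ contextTree P X q ∧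
      (ProperSuffix u w ∨ SuffixEq w (Sum.inl u))} => w.1) fun _ => b) ⟨w, hw, hwu⟩
  have hα : alpha P X q (k + 1) ≤ ∑ b, g b := by
    refine ciInf_le (f := fun u : {u : List A // u.length = k + 1} => ∑ b : A,
      ⨅ w : {w : Str A // w ∈ contextTree P X q ∧
          (ProperSuffix u.1 w ∨ SuffixEq w (Sum.inl u.1))}, condProb P X q w.1 b)
      ⟨0, ?_⟩ ⟨u, hk⟩
    rintro _ ⟨u, rfl⟩
    exact Finset.sum_nonneg fun b _ => Real.iInf_nonneg fun w => condProb_nonneg _ _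
  -- Since `q x` has mass one and dominates `g` off `a`, it gives `a` at most `1 - ∑_{b ≠ a} g b`,
  -- whereas `q y` gives `a` at least `g a`.
  have h1 := sum_kernel_real q x
  rw [← Finset.add_sum_erase _ _ (Finset.mem_univ a)] at h1 hα
  have h2 : ∑ b ∈ Finset.univ.erase a, g b ≤ ∑ b ∈ Finset.univ.erase a, (q x).real {b} :=
    Finset.sum_le_sum fun b _ => hle x hx b
  linarith [hle y hy a]

theorem alpha_zero_le_half [MeasurableSingletonClass A] [Nontrivial A] [IsMarkovKernel q] :
    alpha P X q 0 ≤ 1 / 2 := by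
  classical
  obtain ⟨a, b, hab⟩ := exists_pair_ne A
  have x : ℕ → A := fun _ => a
  have h1 := sum_kernel_real q x
  have h2 : (q x).real {a} + (q x).real {b} ≤ ∑ c, (q x).real {c} := by
    rw [← Finset.sum_pair (f := fun c => (q x).real {c}) hab]
    exact Finset.sum_le_sum_of_subset_of_nonneg (Finset.subset_univ _)
      fun _ _ _ => measureReal_nonneg
  have h3 := alpha_zero_le (P := P) (X := X) (q := q) x a
  have h4 := alpha_zero_le (P := P) (X := X) (q := q) x b
  linarith

end Contexts

/-! ### Stationarity and one-step bounds for word probabilities. -/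

section Stationary

variable {P : Measure Ω} {X : ℤ → Ω → A}

theorem IsStationaryErgodic.measurable_path (hX : IsStationaryErgodic P X) :
    Measurable fun ω t => X t ω :=
  measurable_pi_lambda _ hX.measurable

theorem IsStationaryErgodic.measurable_past (hX : IsStationaryErgodic P X) :
    Measurable (past X) :=
  measurable_pi_lambda _ fun _ => hX.measurable _

theorem IsStationaryErgodic.measureReal_shift (hX : IsStationaryErgodic P X)
    {T : Set (ℤ → A)} (hT : MeasurableSet T) (k : ℕ) :
    P.real {ω | (fun t => X (t + k) ω) ∈ T} = P.real {ω | (fun t => X t ω) ∈ T} := by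
  have h1 := (hX.ergodic.toMeasurePreserving.iterate k).measure_preimage hT.nullMeasurableSet
  have hm := (hX.ergodic.toMeasurePreserving.iterate k).measurable
  rw [Measure.map_apply hX.measurable_path (hm hT), Measure.map_apply hX.measurable_path hT] at h1
  have h2 : (fun ω t => X t ω) ⁻¹' ((fun (x : ℤ → A) (t : ℤ) => x (t + 1))^[k] ⁻¹' T) =
      {ω | (fun t => X (t + k) ω) ∈ T} := by
    ext ω
    simp [shift_iterate]
  rw [h2] at h1
  rw [measureReal_def, h1]
  rfl

variable [Finite A] [MeasurableSingletonClass A]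

theorem measurableSet_ofFn_eq {ι : Type*} {k : ℕ} (g : Fin k → ι) (h : List A) :
    MeasurableSet {z : ι → A | (List.ofFn fun i => z (g i)) = h} := by
  have : Measurable fun (z : ι → A) (i : Fin k) => z (g i) :=
    measurable_pi_lambda _ fun i => measurable_pi_apply _
  exact this (Set.toFinite {y : Fin k → A | List.ofFn y = h}).measurableSet

theorem measurableSet_lastSymbols_eq (k : ℕ) (h : List A) :
    MeasurableSet {z : ℕ → A | lastSymbols z k = h} := by
  have h1 := measurableSet_ofFn_eq (fun i : Fin k => (i : ℕ)) h.reverse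
  convert h1 using 2
  ext z
  rw [lastSymbols, List.reverse_eq_iff]

theorem IsStationaryErgodic.wordProb_eq (hX : IsStationaryErgodic P X) (h : List A) :
    wordProb P X h = P.real {ω | lastSymbols (past X ω) h.length = h} := by
  have := hX.measureReal_shift
    (measurableSet_ofFn_eq (fun i : Fin h.length => ((i : ℤ) - h.length)) h) (h.length + 1)
  simp only [lastSymbols_past]
  refine Eq.trans ?_ this
  rw [wordProb]
  congr 1
  ext ω
  simp only [sample, Set.mem_ofPred_eq]
  have h2 : ∀ i : Fin h.length,
      ((i : ℤ) - h.length + ((h.length + 1 : ℕ) : ℤ)) = (i : ℤ) + 1 := by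
    intro i; push_cast; ring
  simp only [h2]

theorem IsStationaryErgodic.wordProb_concat_eq (hX : IsStationaryErgodic P X) (h : List A)
    (a : A) : wordProb P X (h ++ [a]) =
      P.real ({ω | X 0 ω = a} ∩ {ω | lastSymbols (past X ω) h.length = h}) := by
  have hT : MeasurableSet ({z : ℤ → A | z 0 = a} ∩
      {z | (List.ofFn fun i : Fin h.length => z ((i : ℤ) - h.length)) = h}) :=
    (measurableSet_eq_fun (measurable_pi_apply 0) measurable_const).inter
      (measurableSet_ofFn_eq _ h)
  have := hX.measureReal_shift hT (h.length + 1)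
  simp only [lastSymbols_past]
  refine Eq.trans ?_ this
  rw [wordProb]
  congr 1
  ext ω
  simp only [sample_eq_concat_iff]
  simp only [sample, Set.mem_ofPred_eq, Set.mem_inter_iff]
  have h2 : ∀ i : Fin h.length,
      ((i : ℤ) - h.length + ((h.length + 1 : ℕ) : ℤ)) = (i : ℤ) + 1 := by
    intro i; push_cast; ring
  simp only [h2, zero_add]
  push_cast
  tauto

variable [IsProbabilityMeasure P] {q : Kernel (ℕ → A) A}

/-- Stationarity moves the word to the past of time `0`, where the defining property of conditional
expectation applies on the cylinder. From here on the version `q` is seen only through bounds on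
cylinders. -/
theorem IsTransitionVersion.wordProb_concat (hX : IsStationaryErgodic P X)
    (hq : IsTransitionVersion P X q) (h : List A) (a : A) :
    wordProb P X (h ++ [a]) =
      ∫ ω in {ω | lastSymbols (past X ω) h.length = h}, (q (past X ω)).real {a} ∂P := by
  have hm : MeasurableSpace.comap (past X) inferInstance ≤ ‹MeasurableSpace Ω› :=
    hX.measurable_past.comap_le
  have hS : MeasurableSet {ω | X 0 ω = a} := hX.measurable 0 (measurableSet_singleton a)
  have hC : MeasurableSet[MeasurableSpace.comap (past X) inferInstance]
      {ω | lastSymbols (past X ω) h.length = h} :=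
    ⟨_, measurableSet_lastSymbols_eq h.length h, rfl⟩
  have hind : Integrable ({ω | X 0 ω = a}.indicator fun _ => (1 : ℝ)) P :=
    (integrable_const 1).indicator hS
  rw [hX.wordProb_concat_eq, ← setIntegral_congr_ae (hm _ hC) ((hq a).mono fun ω hω _ => hω),
    setIntegral_condExp hm hind hC, setIntegral_indicator hS, setIntegral_const, Set.inter_comm]
  simp

theorem IsTransitionVersion.wordProb_concat_le (hX : IsStationaryErgodic P X)
    (hq : IsTransitionVersion P X q) {u h : List A} (hu : u <:+ h) {a : A} {r : ℝ}
    (hr : ∀ x, EndsIn x u → (q x).real {a} ≤ r) :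
    wordProb P X (h ++ [a]) ≤ r * wordProb P X h := by
  have hC : MeasurableSet {ω | lastSymbols (past X ω) h.length = h} :=
    hX.measurable_past (measurableSet_lastSymbols_eq h.length h)
  rw [hq.wordProb_concat hX, hX.wordProb_eq]
  refine (setIntegral_mono_on (hq.integrable a).integrableOn
    (integrable_const r).integrableOn hC fun ω hω => hr _ (EndsIn.of_suffix hω hu)).trans_eq ?_
  rw [setIntegral_const, smul_eq_mul, mul_comm]

theorem IsTransitionVersion.le_wordProb_concat (hX : IsStationaryErgodic P X)
    (hq : IsTransitionVersion P X q) {u h : List A} (hu : u <:+ h) {a : A} {r : ℝ}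
    (hr : ∀ x, EndsIn x u → r ≤ (q x).real {a}) :
    r * wordProb P X h ≤ wordProb P X (h ++ [a]) := by
  have hC : MeasurableSet {ω | lastSymbols (past X ω) h.length = h} :=
    hX.measurable_past (measurableSet_lastSymbols_eq h.length h)
  rw [hq.wordProb_concat hX, hX.wordProb_eq]
  refine le_trans (le_of_eq ?_) (setIntegral_mono_on (integrable_const r).integrableOn
    (hq.integrable a).integrableOn hC fun ω hω => hr _ (EndsIn.of_suffix hω hu))
  rw [setIntegral_const, smul_eq_mul, mul_comm]

end Stationary

variable [Fintype A] [MeasurableSingletonClass A] {P : Measure Ω} [IsProbabilityMeasure P]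
  {X : ℤ → Ω → A}

theorem IsStationaryErgodic.sum_wordProb_concat (hX : IsStationaryErgodic P X) (h : List A) :
    ∑ a, wordProb P X (h ++ [a]) = wordProb P X h := by
  simp only [hX.wordProb_concat_eq, hX.wordProb_eq h]
  have hC : MeasurableSet {ω | lastSymbols (past X ω) h.length = h} :=
    hX.measurable_past (measurableSet_lastSymbols_eq h.length h)
  rw [← measureReal_biUnion_finset]
  · congr 1
    ext ω
    simp
  · intro a _ b _ hab
    rw [Function.onFun, Set.disjoint_left]
    rintro ω ⟨h1, -⟩ ⟨h2, -⟩
    exact hab (h1.symm.trans h2)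
  · exact fun a _ => (hX.measurable 0 (measurableSet_singleton a)).inter hC

variable {q : Kernel (ℕ → A) A}

theorem alpha_pow_le_wordProb (hX : IsStationaryErgodic P X) (hq : IsTransitionVersion P X q)
    (hα : 0 ≤ alpha P X q 0) (h y : List A) :
    alpha P X q 0 ^ y.length * wordProb P X h ≤ wordProb P X (h ++ y) := by
  induction y using List.reverseRecOn with
  | nil => simp
  | append_singleton y b ih =>
    rw [← List.append_assoc, List.length_append, List.length_singleton, pow_succ']
    refine le_trans ?_ (hq.le_wordProb_concat hX (List.nil_suffix (l := h ++ y))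
      fun x _ => alpha_zero_le (P := P) (X := X) x b)
    rw [mul_assoc]
    exact mul_le_mul_of_nonneg_left ih hα

/-- If a string does not determine the next symbol, then the transition probabilities are not
constant on the sequences that end in it. -/
theorem exists_lt_of_not_determines (hX : IsStationaryErgodic P X)
    (hq : IsTransitionVersion P X q) (hα : 0 < alpha P X q 0) {w : List A}
    (hw : ¬ Determines P X q w) :
    ∃ x y a, EndsIn x w ∧ EndsIn y w ∧ (q x).real {a} < (q y).real {a} := by
  by_contra! hcon
  refine hw fun x hx a => ?_
  have heq : ∀ y, EndsIn y w → (q y).real {a} = (q x).real {a} := fun y hy =>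
    le_antisymm (hcon x y a hx hy) (hcon y x a hy hx)
  -- Integrating the constant value over the cylinder of `w`, which has positive probability because
  -- `α₀ > 0`, identifies it with `p(a|w)`.
  have h1 := hq.wordProb_concat_le hX (List.suffix_refl w) fun y hy => (heq y hy).le
  have h2 := hq.le_wordProb_concat hX (List.suffix_refl w) fun y hy => (heq y hy).ge
  have h3 := h1.antisymm h2
  rw [hX.wordProb_concat_eq, hX.wordProb_eq] at h3
  have hpos : 0 < wordProb P X w := by
    have := alpha_pow_le_wordProb hX hq hα.le [] w
    rw [wordProb_nil, mul_one, List.nil_append] at this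
    exact (pow_pos hα _).trans_le this
  rw [hX.wordProb_eq] at hpos
  have hC : MeasurableSet {ω | lastSymbols (past X ω) w.length = w} :=
    hX.measurable_past (measurableSet_lastSymbols_eq w.length w)
  have h4 : condProbWord P X w a = (P.real {ω | lastSymbols (past X ω) w.length = w})⁻¹ *
      P.real ({ω | lastSymbols (past X ω) w.length = w} ∩ {ω | X 0 ω = a}) := by
    simp only [condProbWord, measureReal_def]
    rw [cond_apply hC, ENNReal.toReal_mul, ENNReal.toReal_inv]
  rw [h4, Set.inter_comm, h3]
  field_simp

end Chains

/-! ### Supermartingale sums over the tree of words. -/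

section ExtSum

variable {A : Type*} [Fintype A]

/-- The sum of `F (h ++ y)` over all strings `y` of length `n`. -/
def extSum (F : List A → ℝ) : ℕ → List A → ℝ
  | 0, h => F h
  | n + 1, h => ∑ a : A, extSum F n (h ++ [a])

theorem extSum_add_steps (F : List A → ℝ) (m n : ℕ) (h : List A) :
    extSum F (m + n) h = extSum (extSum F n) m h := by
  induction m generalizing h with
  | zero => simp [extSum]
  | succ m ih =>
    rw [show m + 1 + n = m + n + 1 by ring]
    simp only [extSum, ih]

theorem extSum_mono {F G : List A → ℝ} {n : ℕ} {h : List A}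
    (hFG : ∀ y : List A, y.length = n → F (h ++ y) ≤ G (h ++ y)) :
    extSum F n h ≤ extSum G n h := by
  induction n generalizing h with
  | zero => simpa [extSum] using hFG []
  | succ n ih =>
    refine Finset.sum_le_sum fun a _ => ih fun y hy => ?_
    simpa using hFG (a :: y) (by simp [hy])

theorem extSum_const_mul (c : ℝ) (F : List A → ℝ) (n : ℕ) (h : List A) :
    extSum (fun y => c * F y) n h = c * extSum F n h := by
  induction n generalizing h with
  | zero => rfl
  | succ n ih => simp only [extSum, ih, Finset.mul_sum]

theorem extSum_sub (F G : List A → ℝ) (n : ℕ) (h : List A) :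
    extSum (fun y => F y - G y) n h = extSum F n h - extSum G n h := by
  induction n generalizing h with
  | zero => rfl
  | succ n ih => simp only [extSum, ih, Finset.sum_sub_distrib]

/-- This is the supermartingale property iterated: for `F h = P(h) G(h)` it bounds the expectation
of `G` along the sample. -/
theorem extSum_le_self {F : List A → ℝ} (hF : ∀ h, ∑ a, F (h ++ [a]) ≤ F h) (n : ℕ)
    (h : List A) : extSum F n h ≤ F h := by
  induction n generalizing h with
  | zero => exact le_rfl
  | succ n ih => exact (Finset.sum_le_sum fun a _ => ih (h ++ [a])).trans (hF h)

theorem extSum_nonneg {F : List A → ℝ} (hF : ∀ h, 0 ≤ F h) (n : ℕ) (h : List A) :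
    0 ≤ extSum F n h := by
  induction n generalizing h with
  | zero => exact hF h
  | succ n ih => exact Finset.sum_nonneg fun a _ => ih _

theorem apply_append_le_extSum {F : List A → ℝ} (hF : ∀ h, 0 ≤ F h) (h u : List A) :
    F (h ++ u) ≤ extSum F u.length h := by
  induction u generalizing h with
  | nil => simp [extSum]
  | cons b u ih =>
    have h1 := ih (h ++ [b])
    rw [List.append_assoc, List.singleton_append] at h1
    exact h1.trans (Finset.single_le_sum (f := fun a => extSum F u.length (h ++ [a]))
      (fun a _ => extSum_nonneg hF _ _) (Finset.mem_univ b))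

variable {Ω : Type*} [MeasurableSpace Ω]

/-- Markov's inequality in word form. Splitting over the next letter uses only monotonicity and
subadditivity, so no measurability of the event is needed. -/
theorem measureReal_sample_le_extSum (P : Measure Ω) [IsProbabilityMeasure P]
    (X : ℤ → Ω → A) {S : List A → Prop} {G : List A → ℝ} (hG : ∀ y, 0 ≤ G y) (n : ℕ)
    (hS : ∀ y : List A, y.length = n → S y → 1 ≤ G y) :
    P.real {ω | S (sample X n ω)} ≤ extSum (fun y => wordProb P X y * G y) n [] := by
  have key : ∀ (m : ℕ) (h : List A), h.length + m = n →
      P.real {ω | sample X h.length ω = h ∧ S (sample X n ω)} ≤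
        extSum (fun y => wordProb P X y * G y) m h := by
    intro m
    induction m with
    | zero =>
      intro h hn
      simp only [extSum]
      by_cases hSh : S h
      · calc P.real {ω | sample X h.length ω = h ∧ S (sample X n ω)}
            ≤ wordProb P X h := measureReal_mono fun ω hω => hω.1
          _ ≤ wordProb P X h * G h :=
              le_mul_of_one_le_right (wordProb_nonneg P X h) (hS h (by omega) hSh)
      · have : {ω | sample X h.length ω = h ∧ S (sample X n ω)} = ∅ := by
          refine Set.eq_empty_of_forall_notMem ?_
          rintro ω ⟨h1, h2⟩
          rw [← hn, Nat.add_zero, h1] at h2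
          exact hSh h2
        rw [this, measureReal_empty]
        exact mul_nonneg (wordProb_nonneg P X h) (hG h)
    | succ m ih =>
      intro h hn
      obtain ⟨T, hT⟩ : ∃ T : A → Set Ω, T = fun a =>
        {ω | sample X (h ++ [a]).length ω = h ++ [a] ∧ S (sample X n ω)} := ⟨_, rfl⟩
      have hsub : {ω | sample X h.length ω = h ∧ S (sample X n ω)} ⊆ ⋃ a, T a := by
        intro ω hω
        rw [hT]
        exact Set.mem_iUnion.2 ⟨X ((h.length : ℤ) + 1) ω,
          (sample_eq_concat_iff X h _ ω).2 ⟨hω.1, rfl⟩, hω.2⟩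
      have hTle : ∀ a, P.real (T a) ≤ extSum (fun y => wordProb P X y * G y) m (h ++ [a]) := by
        intro a
        rw [hT]
        exact ih (h ++ [a]) (by rw [List.length_append, List.length_singleton]; omega)
      calc P.real {ω | sample X h.length ω = h ∧ S (sample X n ω)}
          ≤ P.real (⋃ a, T a) := measureReal_mono hsub
        _ ≤ ∑ a, P.real (T a) := measureReal_iUnion_fintype_le T
        _ ≤ ∑ a, extSum (fun y => wordProb P X y * G y) m (h ++ [a]) :=
            Finset.sum_le_sum fun a _ => hTle a
        _ = extSum (fun y => wordProb P X y * G y) (m + 1) h := rfl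
  refine le_trans (measureReal_mono fun ω hω => ?_) (key n [] (by simp))
  exact ⟨by simp [sample], hω⟩

end ExtSum

/-! ### Exponential inequalities for counts. -/

section Deviation

variable {Ω A : Type*} [MeasurableSpace Ω] [MeasurableSpace A] [Fintype A]
  [MeasurableSingletonClass A] {P : Measure Ω} [IsProbabilityMeasure P] {X : ℤ → Ω → A}
  {q : Kernel (ℕ → A) A}

theorem extSum_wordProb (hX : IsStationaryErgodic P X) (n : ℕ) (h : List A) :
    extSum (wordProb P X) n h = wordProb P X h := by
  induction n generalizing h with
  | zero => rfl
  | succ n ih => simp only [extSum, ih, hX.sum_wordProb_concat]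

variable [DecidableEq A]

/-- The weight changes only when the history ends in `u` and is long enough. There its mean factor
is at most `e^{-(lr + l²)} (1 + (e^l - 1) p)` with `p ≤ 1` and `l p ≤ l r`, which is at most one by
`e^l - 1 ≤ l + l²`. The sign of `l` selects an upper or a lower bound on `p`. -/
theorem extSum_exp_countNext_le_one (hX : IsStationaryErgodic P X)
    (hq : IsTransitionVersion P X q) {u : List A} {a : A} {l r : ℝ} (hl : |l| ≤ 1)
    (hr : ∀ x, EndsIn x u → l * (q x).real {a} ≤ l * r) (d n : ℕ) :
    extSum (fun y => wordProb P X y *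
      Real.exp (l * ((countNext d y u a : ℝ) - r * count d y u) - l ^ 2 * count d y u)) n [] ≤
      1 := by
  refine (extSum_le_self (fun h => ?_) n []).trans ?_
  swap
  · simp [wordProb_nil, countNext_nil, count_nil]
  by_cases hc : d ≤ h.length ∧ u <:+ h
  · have hstep : ∀ b, Real.exp (l * ((countNext d (h ++ [b]) u a : ℝ) -
        r * count d (h ++ [b]) u) - l ^ 2 * count d (h ++ [b]) u) =
        Real.exp (l * ((countNext d h u a : ℝ) - r * count d h u) - l ^ 2 * count d h u) *
        (Real.exp (-(l * r + l ^ 2)) * (1 + if a = b then Real.exp l - 1 else 0)) := by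
      intro b
      rw [countNext_concat, count_concat]
      simp only [hc.1, hc.2, true_and, and_self, if_true]
      split_ifs
      · rw [add_sub_cancel, ← Real.exp_add, ← Real.exp_add]
        congr 1
        push_cast
        ring
      · rw [add_zero, add_zero, mul_one, ← Real.exp_add]
        congr 1
        push_cast
        ring
    have hsum : ∑ b, wordProb P X (h ++ [b]) * (1 + if a = b then Real.exp l - 1 else 0) =
        wordProb P X h + wordProb P X (h ++ [a]) * (Real.exp l - 1) := by
      simp only [mul_add, mul_one, Finset.sum_add_distrib, hX.sum_wordProb_concat, mul_ite,
        mul_zero, Finset.sum_ite_eq, Finset.mem_univ, if_true]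
    have hπ := wordProb_nonneg P X h
    have hπa := wordProb_nonneg P X (h ++ [a])
    have hle : wordProb P X (h ++ [a]) ≤ wordProb P X h := by
      rw [← hX.sum_wordProb_concat h]
      exact Finset.single_le_sum (f := fun b => wordProb P X (h ++ [b]))
        (fun b _ => wordProb_nonneg P X _) (Finset.mem_univ a)
    have hla : l * wordProb P X (h ++ [a]) ≤ l * (r * wordProb P X h) := by
      rcases lt_trichotomy l 0 with h0 | h0 | h0
      · exact mul_le_mul_of_nonpos_left (hq.le_wordProb_concat hX hc.2 fun x hx =>
          (mul_le_mul_left_of_neg h0).1 (hr x hx)) h0.le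
      · simp [h0]
      · exact mul_le_mul_of_nonneg_left (hq.wordProb_concat_le hX hc.2 fun x hx =>
          le_of_mul_le_mul_left (hr x hx) h0) h0.le
    have hexp : Real.exp l - 1 ≤ l + l ^ 2 := by
      have := (abs_le.1 (Real.abs_exp_sub_one_sub_id_le hl)).2
      linarith
    have hmain : wordProb P X h + wordProb P X (h ++ [a]) * (Real.exp l - 1) ≤
        wordProb P X h * Real.exp (l * r + l ^ 2) := by
      have h1 := mul_le_mul_of_nonneg_left hexp hπa
      have h2 := mul_le_mul_of_nonneg_left hle (sq_nonneg l)
      have h3 := mul_le_mul_of_nonneg_left (Real.add_one_le_exp (l * r + l ^ 2)) hπ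
      linarith
    simp only [hstep]
    set E := Real.exp (l * ((countNext d h u a : ℝ) - r * count d h u) - l ^ 2 * count d h u)
    calc ∑ b, wordProb P X (h ++ [b]) *
          (E * (Real.exp (-(l * r + l ^ 2)) * (1 + if a = b then Real.exp l - 1 else 0)))
        = E * Real.exp (-(l * r + l ^ 2)) * ∑ b, wordProb P X (h ++ [b]) *
          (1 + if a = b then Real.exp l - 1 else 0) := by
          rw [Finset.mul_sum]
          exact Finset.sum_congr rfl fun b _ => by ring
      _ ≤ E * Real.exp (-(l * r + l ^ 2)) *
          (wordProb P X h * Real.exp (l * r + l ^ 2)) := by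
          rw [hsum]
          exact mul_le_mul_of_nonneg_left hmain (by positivity)
      _ = wordProb P X h * E * (Real.exp (-(l * r + l ^ 2)) * Real.exp (l * r + l ^ 2)) := by
          ring
      _ = wordProb P X h * E := by rw [← Real.exp_add]; simp
  · have hstep : ∀ b, countNext d (h ++ [b]) u a = countNext d h u a := fun b => by
      rw [countNext_concat, if_neg (by tauto), add_zero]
    have hstep' : ∀ b, count d (h ++ [b]) u = count d h u := fun b => by
      rw [count_concat, if_neg hc, add_zero]
    simp only [hstep, hstep']
    rw [← Finset.sum_mul, hX.sum_wordProb_concat]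

theorem measureReal_deviation_le (hX : IsStationaryErgodic P X)
    (hq : IsTransitionVersion P X q) {u : List A} {a : A} {l r : ℝ} (hl : |l| ≤ 1)
    (hr : ∀ x, EndsIn x u → l * (q x).real {a} ≤ l * r) (s : ℝ) (d n : ℕ) :
    P.real {ω | s ≤ l * ((countNext d (sample X n ω) u a : ℝ) -
      r * count d (sample X n ω) u) - l ^ 2 * count d (sample X n ω) u} ≤ Real.exp (-s) := by
  refine (measureReal_sample_le_extSum P X
    (S := fun y => s ≤ l * ((countNext d y u a : ℝ) - r * count d y u) - l ^ 2 * count d y u)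
    (G := fun y => Real.exp (-s) *
      Real.exp (l * ((countNext d y u a : ℝ) - r * count d y u) - l ^ 2 * count d y u))
    (fun y => by positivity) n fun y _ hy => ?_).trans ?_
  · rw [← Real.exp_add]
    exact Real.one_le_exp (by linarith)
  · simp only [mul_left_comm (wordProb P X _)]
    rw [extSum_const_mul]
    exact mul_le_of_le_one_right (Real.exp_nonneg _)
      (extSum_exp_countNext_le_one hX hq hl hr d n)

/-- The choice `l = β/2` maximizes `l β - l²`, with value `β²/4`. -/
theorem measureReal_upper_deviation_le (hX : IsStationaryErgodic P X)
    (hq : IsTransitionVersion P X q) {u : List A} {a : A} {r β : ℝ} (hβ : 0 ≤ β) (hβ2 : β ≤ 2)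
    (hr : ∀ x, EndsIn x u → (q x).real {a} ≤ r) (s : ℝ) (d n : ℕ) :
    P.real {ω | (r + β) * count d (sample X n ω) u ≤ countNext d (sample X n ω) u a ∧
      s ≤ count d (sample X n ω) u} ≤ Real.exp (-(β ^ 2 * s / 4)) := by
  refine le_trans (measureReal_mono ?_) (measureReal_deviation_le hX hq (l := β / 2) (r := r)
    (u := u) (a := a)
    (abs_le.2 ⟨by linarith, by linarith⟩)
    (fun x hx => mul_le_mul_of_nonneg_left (hr x hx) (by linarith)) (β ^ 2 * s / 4) d n)
  rintro ω ⟨h1, h2⟩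
  have h3 := mul_le_mul_of_nonneg_left h1 hβ
  have h4 := mul_le_mul_of_nonneg_left h2 (sq_nonneg β)
  rw [Set.mem_ofPred_eq]
  linarith

theorem measureReal_lower_deviation_le (hX : IsStationaryErgodic P X)
    (hq : IsTransitionVersion P X q) {u : List A} {a : A} {r β : ℝ} (hβ : 0 ≤ β) (hβ2 : β ≤ 2)
    (hr : ∀ x, EndsIn x u → r ≤ (q x).real {a}) (s : ℝ) (d n : ℕ) :
    P.real {ω | countNext d (sample X n ω) u a ≤ (r - β) * count d (sample X n ω) u ∧
      s ≤ count d (sample X n ω) u} ≤ Real.exp (-(β ^ 2 * s / 4)) := by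
  refine le_trans (measureReal_mono ?_) (measureReal_deviation_le hX hq (l := -(β / 2)) (r := r)
    (u := u) (a := a)
    (abs_le.2 ⟨by linarith, by linarith⟩)
    (fun x hx => mul_le_mul_of_nonpos_left (hr x hx) (by linarith)) (β ^ 2 * s / 4) d n)
  rintro ω ⟨h1, h2⟩
  have h3 := mul_le_mul_of_nonneg_left h1 hβ
  have h4 := mul_le_mul_of_nonneg_left h2 (sq_nonneg β)
  rw [Set.mem_ofPred_eq]
  linarith

theorem sum_wordProb_exp_neg_count_le (hX : IsStationaryErgodic P X) (u : List A) (d : ℕ)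
    (h : List A) :
    ∑ a, wordProb P X (h ++ [a]) * Real.exp (-(count d (h ++ [a]) u : ℝ)) ≤
      wordProb P X h * Real.exp (-(count d h u : ℝ)) := by
  rw [← hX.sum_wordProb_concat h, Finset.sum_mul]
  refine Finset.sum_le_sum fun a _ => mul_le_mul_of_nonneg_left ?_ (wordProb_nonneg P X _)
  exact Real.exp_le_exp.2 (neg_le_neg (Nat.cast_le.2 (count_le_count_append d h [a] u)))

/-- Over a block of length `ℓ(u) + 1` the string `u` occurs with probability at least
`α₀ ^ ℓ(u)`, whatever the past. -/
theorem extSum_exp_neg_count_block_le (hX : IsStationaryErgodic P X)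
    (hq : IsTransitionVersion P X q) (hα : 0 ≤ alpha P X q 0) (u : List A) (d : ℕ)
    {h : List A} (hd : d ≤ h.length) :
    extSum (fun y => wordProb P X y * Real.exp (-(count d y u : ℝ))) (u.length + 1) h ≤
      Real.exp (-(alpha P X q 0 ^ u.length / 2)) *
        (wordProb P X h * Real.exp (-(count d h u : ℝ))) := by
  -- `H` carries the mass of the continuations by `u` and one more letter; that letter must be
  -- observed for this occurrence of `u` to be counted, whence the block length `ℓ(u) + 1`.
  set H : List A → ℝ := fun y => if y.dropLast = h ++ u then wordProb P X y else 0 with hH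
  have hH0 : ∀ y, 0 ≤ H y := fun y => by
    simp only [hH]
    split_ifs
    · exact wordProb_nonneg P X y
    · exact le_rfl
  have hHsum : wordProb P X (h ++ u) ≤ extSum H (u.length + 1) h := by
    rw [extSum_add_steps]
    refine le_trans (le_of_eq ?_)
      (apply_append_le_extSum (F := extSum H 1) (fun y => extSum_nonneg hH0 1 y) h u)
    simp only [extSum, hH, List.dropLast_concat, if_true, hX.sum_wordProb_concat]
  have hbound : extSum (fun y => wordProb P X y * Real.exp (-(count d y u : ℝ)))
      (u.length + 1) h ≤ extSum (fun y => Real.exp (-(count d h u : ℝ)) *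
        (wordProb P X y - 1 / 2 * H y)) (u.length + 1) h := by
    refine extSum_mono fun y hy => ?_
    have hle : Real.exp (-(count d (h ++ y) u : ℝ)) ≤ Real.exp (-(count d h u : ℝ)) :=
      Real.exp_le_exp.2 (neg_le_neg (Nat.cast_le.2 (count_le_count_append d h y u)))
    have hπ := wordProb_nonneg P X (h ++ y)
    simp only [hH]
    split_ifs with hdl
    · have hne : h ++ y ≠ [] := by
        intro h0
        have := congrArg List.length h0
        simp [hy] at this
      have hyb := List.dropLast_append_getLast hne
      rw [hdl] at hyb
      have hcount : count d h u + 1 ≤ count d (h ++ y) u := by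
        rw [← hyb, count_concat, if_pos ⟨by simp; omega, List.suffix_append _ _⟩]
        exact Nat.add_le_add_right (count_le_count_append d h u u) 1
      have hexp : Real.exp (-(count d (h ++ y) u : ℝ)) ≤
          Real.exp (-(count d h u : ℝ)) * (1 / 2) := by
        have h1 : (count d h u : ℝ) + 1 ≤ count d (h ++ y) u := by exact_mod_cast hcount
        have h2 : Real.exp (-1) ≤ 1 / 2 := by
          rw [Real.exp_neg, one_div]
          exact inv_anti₀ two_pos (by linarith [Real.add_one_le_exp (1 : ℝ)])
        calc Real.exp (-(count d (h ++ y) u : ℝ)) ≤ Real.exp (-(count d h u : ℝ) + -1) :=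
              Real.exp_le_exp.2 (by linarith)
          _ = Real.exp (-(count d h u : ℝ)) * Real.exp (-1) := Real.exp_add _ _
          _ ≤ _ := mul_le_mul_of_nonneg_left h2 (Real.exp_nonneg _)
      have := mul_le_mul_of_nonneg_left hexp hπ
      linarith
    · have := mul_le_mul_of_nonneg_left hle hπ
      linarith
  refine hbound.trans ?_
  rw [extSum_const_mul, extSum_sub (wordProb P X), extSum_const_mul, extSum_wordProb hX]
  have h1 := alpha_pow_le_wordProb hX hq hα h u
  have h2 := Real.add_one_le_exp (-(alpha P X q 0 ^ u.length / 2))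
  have h3 := mul_le_mul_of_nonneg_right h2 (wordProb_nonneg P X h)
  have h4 : wordProb P X h - 1 / 2 * extSum H (u.length + 1) h ≤
      Real.exp (-(alpha P X q 0 ^ u.length / 2)) * wordProb P X h := by linarith
  calc _ ≤ Real.exp (-(count d h u : ℝ)) *
        (Real.exp (-(alpha P X q 0 ^ u.length / 2)) * wordProb P X h) :=
        mul_le_mul_of_nonneg_left h4 (Real.exp_nonneg _)
    _ = _ := by ring

/-- Lower tail of the number of occurrences of a string. -/
theorem measureReal_count_le_le (hX : IsStationaryErgodic P X)
    (hq : IsTransitionVersion P X q) (hα : 0 ≤ alpha P X q 0) (u : List A) {d m n : ℕ}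
    (hn : d + m * (u.length + 1) ≤ n) :
    P.real {ω | (count d (sample X n ω) u : ℝ) ≤ m * alpha P X q 0 ^ u.length / 4} ≤
      Real.exp (-(m * alpha P X q 0 ^ u.length / 4)) := by
  set κ := alpha P X q 0 ^ u.length with hκ
  obtain ⟨r, rfl⟩ := Nat.exists_eq_add_of_le hn
  set F : List A → ℝ := fun y => wordProb P X y * Real.exp (-(count d y u : ℝ)) with hF
  have hsuper : ∀ h, ∑ a, F (h ++ [a]) ≤ F h := sum_wordProb_exp_neg_count_le hX u d
  -- Each block contributes a factor `exp(-κ/2)`; the first `d` and the last `r` symbols are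
  -- absorbed by the supermartingale property.
  have hblocks : ∀ (m : ℕ) (h : List A), d ≤ h.length →
      extSum F (m * (u.length + 1) + r) h ≤ Real.exp (-(m * κ / 2)) * F h := by
    intro m
    induction m with
    | zero =>
      intro h _
      simpa using extSum_le_self hsuper r h
    | succ m ih =>
      intro h hd
      rw [show (m + 1) * (u.length + 1) + r = (u.length + 1) + (m * (u.length + 1) + r) by ring,
        extSum_add_steps]
      calc extSum (extSum F (m * (u.length + 1) + r)) (u.length + 1) h
          ≤ extSum (fun y => Real.exp (-(m * κ / 2)) * F y) (u.length + 1) h :=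
            extSum_mono fun y _ => ih _ (by simp; omega)
        _ = Real.exp (-(m * κ / 2)) * extSum F (u.length + 1) h := extSum_const_mul _ _ _ _
        _ ≤ Real.exp (-(m * κ / 2)) * (Real.exp (-(κ / 2)) * F h) :=
            mul_le_mul_of_nonneg_left (extSum_exp_neg_count_block_le hX hq hα u d hd)
              (Real.exp_nonneg _)
        _ = Real.exp (-((m + 1 : ℕ) * κ / 2)) * F h := by
            rw [← mul_assoc, ← Real.exp_add]
            congr 2
            push_cast
            ring
  have htotal : extSum F (d + m * (u.length + 1) + r) [] ≤ Real.exp (-(m * κ / 2)) := by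
    rw [add_assoc, extSum_add_steps]
    calc extSum (extSum F (m * (u.length + 1) + r)) d []
        ≤ extSum (fun y => Real.exp (-(m * κ / 2)) * F y) d [] :=
          extSum_mono fun y hy => hblocks m _ (by simp [hy])
      _ = Real.exp (-(m * κ / 2)) * extSum F d [] := extSum_const_mul _ _ _ _
      _ ≤ Real.exp (-(m * κ / 2)) * F [] :=
          mul_le_mul_of_nonneg_left (extSum_le_self hsuper d []) (Real.exp_nonneg _)
      _ = Real.exp (-(m * κ / 2)) := by simp [hF, wordProb_nil, count_nil]
  refine (measureReal_sample_le_extSum P X (S := fun y => (count d y u : ℝ) ≤ m * κ / 4)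
    (G := fun y => Real.exp (m * κ / 4) * Real.exp (-(count d y u : ℝ)))
    (fun y => by positivity) _ fun y _ hy => ?_).trans ?_
  · rw [← Real.exp_add]
    exact Real.one_le_exp (by linarith)
  · simp only [mul_left_comm (wordProb P X _)]
    rw [extSum_const_mul]
    calc Real.exp (m * κ / 4) * extSum F (d + m * (u.length + 1) + r) []
        ≤ Real.exp (m * κ / 4) * Real.exp (-(m * κ / 2)) :=
          mul_le_mul_of_nonneg_left htotal (Real.exp_nonneg _)
      _ = _ := by
          rw [← Real.exp_add]
          congr 1
          ring

end Deviation

/-! ### Underestimation and overestimation bounds. -/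

section Rates

variable {Ω A : Type*} [MeasurableSpace Ω] [MeasurableSpace A] [Fintype A] [DecidableEq A]
  [MeasurableSingletonClass A] {P : Measure Ω} [IsProbabilityMeasure P] {X : ℤ → Ω → A}
  {q : Kernel (ℕ → A) A}

/-- If `w` does not determine the next symbol, then refining the leaf `w` increases the
log-likelihood linearly, outside an event of exponentially small probability. -/
theorem exists_gain_bound [IsMarkovKernel q] (hX : IsStationaryErgodic P X)
    (hq : IsTransitionVersion P X q) (hreg : Regular P X q) {w : List A}
    (hw : ¬ Determines P X q w) :
    ∃ (C c δ : ℝ) (k : ℕ), 0 < C ∧ 0 < c ∧ 0 < δ ∧ w.length ≤ k ∧ ∀ d n : ℕ, k ≤ d →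
      d + k + 1 ≤ n →
      P.real {ω | ¬ ((∀ u ∈ extensions w k, 1 ≤ count d (sample X n ω) u) ∧
        δ * ((n : ℝ) - d) ≤ ∑ u ∈ extensions w k, logLik d (sample X n ω) u -
          logLik d (sample X n ω) w)} ≤ C * Real.exp (-(c * ((n : ℝ) - d))) := by
  have hα := hreg.alpha_zero_pos
  obtain ⟨x, y, a, hx, hy, hlt⟩ := exists_lt_of_not_determines hX hq hα hw
  set η := (q y).real {a} - (q x).real {a} with hη
  have hη0 : 0 < η := sub_pos.2 hlt
  have hη1 : η ≤ 1 := by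
    have h1 : (q y).real {a} ≤ 1 := measureReal_le_one
    have h2 : 0 ≤ (q x).real {a} := measureReal_nonneg
    linarith
  -- An oscillation below `η/4` at each of the two strings, plus an empirical error `η/8` at each,
  -- leaves a gap `η - 2(η/4 + η/8) = η/4`.
  obtain ⟨k, hk, hwk⟩ : ∃ k, 1 - alpha P X q (k + 1) < η / 4 ∧ w.length ≤ k + 1 := by
    have h1 := (hreg.summable.tendsto_atTop_zero.comp (tendsto_add_atTop_nat 1)).eventually
      (gt_mem_nhds (show (0 : ℝ) < η / 4 by linarith))
    obtain ⟨k, hk, hk'⟩ := (h1.and (eventually_ge_atTop w.length)).exists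
    exact ⟨k, hk, by omega⟩
  have hosc : ∀ z z', EndsIn z' (lastSymbols z (k + 1)) →
      (q z').real {a} ≤ (q z).real {a} + η / 4 ∧ (q z).real {a} - η / 4 ≤ (q z').real {a} := by
    intro z z' hz'
    have h1 := kernel_real_sub_le (P := P) (X := X) (q := q) (lastSymbols_length z (k + 1))
      hz' (endsIn_lastSymbols z (k + 1)) a
    have h2 := kernel_real_sub_le (P := P) (X := X) (q := q) (lastSymbols_length z (k + 1))
      (endsIn_lastSymbols z (k + 1)) hz' a
    constructor <;> linarith
  set u₁ := lastSymbols x (k + 1) with hu₁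
  set u₂ := lastSymbols y (k + 1) with hu₂
  have hmem₁ : u₁ ∈ extensions w (k + 1) :=
    mem_extensions.2 ⟨lastSymbols_length _ _, EndsIn.suffix_lastSymbols hx hwk⟩
  have hmem₂ : u₂ ∈ extensions w (k + 1) :=
    mem_extensions.2 ⟨lastSymbols_length _ _, EndsIn.suffix_lastSymbols hy hwk⟩
  set κ := alpha P X q 0 ^ (k + 1) with hκ
  have hκ0 : 0 < κ := pow_pos hα _
  -- Blocks have length `k + 2`, and rounding down their number `m` loses at most a factor `2`; this
  -- makes `s₀ (n - d) ≤ m κ / 4`.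
  set s₀ : ℝ := κ / (8 * (k + 2)) with hs₀
  have hs₀0 : 0 < s₀ := by positivity
  refine ⟨(Fintype.card A : ℝ) ^ (k + 1) + 2, s₀ * ((η / 8) ^ 2 / 4), s₀ * (η / 4) ^ 2 / 8, k + 1,
    by positivity, by positivity, by positivity, hwk, fun d n hd hn => ?_⟩
  set D : ℝ := (n : ℝ) - d with hD
  have hD0 : 0 < D := by
    have : (d : ℝ) + (k + 1 : ℕ) + 1 ≤ n := by exact_mod_cast hn
    push_cast at this
    have : (0 : ℝ) ≤ k := by positivity
    linarith
  set m : ℕ := (n - d) / (k + 2) with hm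
  have hmn : d + m * (k + 2) ≤ n := by
    have := Nat.div_mul_le_self (n - d) (k + 2)
    rw [← hm] at this
    omega
  have hmD : s₀ * D ≤ m * κ / 4 := by
    have h1 : 1 ≤ m := (Nat.one_le_div_iff (by omega)).2 (by omega)
    have h2 : n - d < (m + 1) * (k + 2) := by
      have := Nat.lt_div_mul_add (a := n - d) (b := k + 2) (by omega)
      rw [← hm] at this
      linarith
    have h3 : n ≤ d + 2 * m * (k + 2) := by
      have : (m + 1) * (k + 2) ≤ 2 * m * (k + 2) := Nat.mul_le_mul_right _ (by omega)
      omega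
    have h4 : D ≤ 2 * m * (k + 2) := by
      have : (n : ℝ) ≤ d + 2 * m * (k + 2) := by exact_mod_cast h3
      linarith
    calc s₀ * D ≤ s₀ * (2 * m * (k + 2)) := mul_le_mul_of_nonneg_left h4 hs₀0.le
      _ = m * κ / 4 := by rw [hs₀]; field_simp; ring
  set B : List A → Set Ω := fun u => {ω | (count d (sample X n ω) u : ℝ) ≤ m * κ / 4} with hB
  have hBle : ∀ u ∈ words A (k + 1), P.real (B u) ≤ Real.exp (-(s₀ * D)) := by
    intro u hu
    have hul := mem_words.1 hu
    have h1 := measureReal_count_le_le hX hq hα.le u (d := d) (m := m) (n := n)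
      (by rw [hul]; exact hmn)
    rw [hul] at h1
    exact h1.trans (Real.exp_le_exp.2 (neg_le_neg hmD))
  have hD₁ := measureReal_upper_deviation_le hX hq (u := u₁) (a := a) (β := η / 8) (by linarith)
    (by linarith) (fun z hz => (hosc x z hz).1) (s₀ * D) d n
  have hD₂ := measureReal_lower_deviation_le hX hq (u := u₂) (a := a) (β := η / 8) (by linarith)
    (by linarith) (fun z hz => (hosc y z hz).2) (s₀ * D) d n
  set E₁ : Set Ω := {ω | ((q x).real {a} + η / 4 + η / 8) * count d (sample X n ω) u₁ ≤
    countNext d (sample X n ω) u₁ a ∧ s₀ * D ≤ count d (sample X n ω) u₁}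
  set E₂ : Set Ω := {ω | countNext d (sample X n ω) u₂ a ≤
    ((q y).real {a} - η / 4 - η / 8) * count d (sample X n ω) u₂ ∧
    s₀ * D ≤ count d (sample X n ω) u₂}
  have hsub : {ω | ¬ ((∀ u ∈ extensions w (k + 1), 1 ≤ count d (sample X n ω) u) ∧
        s₀ * (η / 4) ^ 2 / 8 * D ≤ ∑ u ∈ extensions w (k + 1), logLik d (sample X n ω) u -
          logLik d (sample X n ω) w)} ⊆ (⋃ u ∈ words A (k + 1), B u) ∪ E₁ ∪ E₂ := by
    intro ω hω
    by_contra hcon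
    refine hω ?_
    simp only [Set.mem_union, not_or, Set.mem_iUnion, not_exists] at hcon
    obtain ⟨⟨hnB, hn₁⟩, hn₂⟩ := hcon
    have hcount : ∀ u ∈ extensions w (k + 1), s₀ * D < count d (sample X n ω) u := by
      intro u hu
      have := hnB u (mem_words.2 (mem_extensions.1 hu).1)
      exact hmD.trans_lt (not_le.1 this)
    have hsD : 0 < s₀ * D := mul_pos hs₀0 hD0
    have hocc : ∀ u ∈ extensions w (k + 1), 1 ≤ count d (sample X n ω) u := fun u hu =>
      Nat.cast_pos.1 (hsD.trans (hcount u hu))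
    have hc₁ := hcount u₁ hmem₁
    have hc₂ := hcount u₂ hmem₂
    have hlt₁ : (countNext d (sample X n ω) u₁ a : ℝ) / count d (sample X n ω) u₁ <
        (q x).real {a} + η / 4 + η / 8 := by
      rw [div_lt_iff₀ (hsD.trans hc₁)]
      exact not_le.1 fun hle => hn₁ ⟨hle, hc₁.le⟩
    have hlt₂ : (q y).real {a} - η / 4 - η / 8 <
        (countNext d (sample X n ω) u₂ a : ℝ) / count d (sample X n ω) u₂ := by
      rw [lt_div_iff₀ (hsD.trans hc₂)]
      exact not_le.1 fun hle => hn₂ ⟨hle, hc₂.le⟩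
    refine ⟨hocc, le_trans (le_of_eq (by ring)) (le_gain hwk hd hocc hmem₁ hmem₂ a hsD.le
      (show 0 < η / 4 by linarith) hc₁.le hc₂.le (by linarith))⟩
  have hexp : Real.exp (-(s₀ * D)) ≤ Real.exp (-(s₀ * ((η / 8) ^ 2 / 4) * D)) := by
    refine Real.exp_le_exp.2 (neg_le_neg ?_)
    have h1 : (η / 8) ^ 2 / 4 ≤ 1 := by nlinarith
    have h2 := mul_le_mul_of_nonneg_left h1 (mul_pos hs₀0 hD0).le
    linarith
  have hexp' : Real.exp (-((η / 8) ^ 2 * (s₀ * D) / 4)) =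
      Real.exp (-(s₀ * ((η / 8) ^ 2 / 4) * D)) := by
    congr 1
    ring
  calc _ ≤ P.real ((⋃ u ∈ words A (k + 1), B u) ∪ E₁ ∪ E₂) := measureReal_mono hsub (measure_ne_top _ _)
    _ ≤ P.real (⋃ u ∈ words A (k + 1), B u) + P.real E₁ + P.real E₂ :=
        (measureReal_union_le _ _).trans (add_le_add_left (measureReal_union_le _ _) _)
    _ ≤ ∑ u ∈ words A (k + 1), Real.exp (-(s₀ * ((η / 8) ^ 2 / 4) * D)) +
          Real.exp (-(s₀ * ((η / 8) ^ 2 / 4) * D)) +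
          Real.exp (-(s₀ * ((η / 8) ^ 2 / 4) * D)) := by
        refine add_le_add (add_le_add ?_ (hD₁.trans_eq hexp')) (hD₂.trans_eq hexp')
        exact (measureReal_biUnion_finset_le _ _).trans
          (Finset.sum_le_sum fun u hu => (hBle u hu).trans hexp)
    _ = _ := by
        rw [Finset.sum_const, card_words, nsmul_eq_mul]
        push_cast
        ring

theorem exists_pos_le_of_finset {ι : Type*} (s : Finset ι) (c : ι → ℝ) (hc : ∀ i ∈ s, 0 < c i) :
    ∃ b, 0 < b ∧ ∀ i ∈ s, b ≤ c i := by
  rcases s.eq_empty_or_nonempty with rfl | hs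
  · exact ⟨1, one_pos, by simp⟩
  · obtain ⟨i, hi, h⟩ := s.exists_min_image c hs
    exact ⟨c i, hc i hi, h⟩

/-- Exponential bound for the probability of underestimation. -/
theorem exists_underEvent_bound [Nontrivial A] [IsMarkovKernel q] (hX : IsStationaryErgodic P X)
    (hq : IsTransitionVersion P X q) (hreg : Regular P X q) (K : ℕ) :
    ∃ c₁ c₂ : ℝ, 0 < c₁ ∧ 0 < c₂ ∧
      ∀ (d : ℕ → ℕ) (f : ℕ → ℝ) (est : List A → Finset (List A)),
        IsMaxHeight d → IsPenalizing f → IsPLEstimator d f est →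
        Tendsto (fun m : ℕ => f m / ((m : ℝ) - (d m : ℝ))) atTop (𝓝 0) →
        ∀ᶠ n in atTop, P.real (underEvent X (contextTree P X q) est K n) ≤
          c₁ * Real.exp (-(c₂ * ((n : ℝ) - (d n : ℝ)))) := by
  classical
  set W : Finset (List A) := (wordsLE A K).filter fun w => ¬ Determines P X q w with hW
  have hex : ∀ w : List A, ¬ Determines P X q w → _ :=
    fun w hw => exists_gain_bound hX hq hreg hw
  choose! C c δ k hC hc hδ hk hbound using hex
  have hWd : ∀ w ∈ W, ¬ Determines P X q w := fun w hw => (Finset.mem_filter.1 hw).2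
  obtain ⟨c₂, hc₂, hc₂le⟩ := exists_pos_le_of_finset W c fun w hw => hc w (hWd w hw)
  have hCsum : 0 ≤ ∑ w ∈ W, C w := Finset.sum_nonneg fun w hw => (hC w (hWd w hw)).le
  -- The summand `1` keeps the constant positive when `W` is empty.
  refine ⟨1 + ∑ w ∈ W, C w, c₂, by linarith, hc₂, fun d f est hd hf hest hlim => ?_⟩
  -- Together with `f → ∞` this makes `n - d n` exceed every fixed length.
  have hfd : ∀ᶠ n in atTop, f n < (n : ℝ) - d n := by
    filter_upwards [hlim.eventually (gt_mem_nhds one_pos), eventually_ge_atTop 1] with n h1 hn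
    have h2 : (d n : ℝ) < n := Nat.cast_lt.2 (hd.lt n hn)
    rwa [div_lt_one (by linarith)] at h1
  have hW_ev : ∀ᶠ n in atTop, ∀ w ∈ W, k w ≤ d n ∧ d n + k w + 1 ≤ n ∧
      (Fintype.card A : ℝ) ^ k w * f n < δ w * ((n : ℝ) - d n) := by
    rw [Filter.eventually_all_finset]
    intro w hw
    have hA : (0 : ℝ) < (Fintype.card A : ℝ) ^ k w := by
      have : 0 < Fintype.card A := Fintype.card_pos
      positivity
    filter_upwards [hfd, hd.tendsto_atTop.eventually_ge_atTop (k w),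
      hf.tendsto_atTop.eventually_ge_atTop ((k w : ℝ) + 1), eventually_ge_atTop 1,
      hlim.eventually (gt_mem_nhds (div_pos (hδ w (hWd w hw)) hA))] with n h1 h2 h3 hn h4
    have h5 : (d n : ℝ) < n := Nat.cast_lt.2 (hd.lt n hn)
    refine ⟨h2, ?_, ?_⟩
    · have : ((d n + k w + 1 : ℕ) : ℝ) ≤ (n : ℝ) := by push_cast; linarith
      exact_mod_cast this
    · rw [div_lt_div_iff₀ (by linarith) hA] at h4
      linarith
  filter_upwards [hW_ev, eventually_ge_atTop 1] with n hn hn1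
  have hD0 : 0 ≤ (n : ℝ) - d n := sub_nonneg.2 (Nat.cast_le.2 (hd.lt n hn1).le)
  set B : List A → Set Ω := fun w => {ω | ¬ ((∀ u ∈ extensions w (k w),
    1 ≤ count (d n) (sample X n ω) u) ∧ δ w * ((n : ℝ) - d n) ≤
    ∑ u ∈ extensions w (k w), logLik (d n) (sample X n ω) u - logLik (d n) (sample X n ω) w)}
    with hB
  have hsub : underEvent X (contextTree P X q) est K n ⊆ ⋃ w ∈ W, B w := by
    rintro ω ⟨w, hw, hwest⟩
    obtain ⟨hwK, hwd⟩ := of_mem_interior_trunc hw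
    have hwW : w ∈ W := Finset.mem_filter.2 ⟨mem_wordsLE.2 hwK.le, hwd⟩
    refine Set.mem_iUnion₂.2 ⟨w, hwW, ?_⟩
    rintro ⟨hocc, hgain⟩
    obtain ⟨h1, h2, h3⟩ := hn w hwW
    have hne : sample X n ω ≠ [] := by
      intro h0
      have := sample_length X n ω
      rw [h0, List.length_nil] at this
      omega
    obtain ⟨hfeas, hmin⟩ := hest _ hne
    rw [sample_length] at hfeas hmin
    have := hfeas.gain_le (hf.pos n) hmin hwest (hk w hwd) h1 hocc
    linarith
  calc P.real (underEvent X (contextTree P X q) est K n)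
      ≤ P.real (⋃ w ∈ W, B w) := measureReal_mono hsub (measure_ne_top _ _)
    _ ≤ ∑ w ∈ W, P.real (B w) := measureReal_biUnion_finset_le _ _
    _ ≤ ∑ w ∈ W, C w * Real.exp (-(c₂ * ((n : ℝ) - d n))) := by
        refine Finset.sum_le_sum fun w hw => ?_
        have hwd := hWd w hw
        refine (hbound w hwd (d n) n (hn w hw).1 (hn w hw).2.1).trans ?_
        refine mul_le_mul_of_nonneg_left (Real.exp_le_exp.2 (neg_le_neg ?_)) (hC w hwd).le
        exact mul_le_mul_of_nonneg_right (hc₂le w hw) hD0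
    _ ≤ _ := by
        rw [← Finset.sum_mul]
        exact mul_le_mul_of_nonneg_right (by linarith) (Real.exp_nonneg _)

/-- Probability that the empirical distribution after `u` is far from the true one, if the
latter is the same for all pasts that end in `u`. -/
theorem measureReal_far_le [Nontrivial A] [IsMarkovKernel q] (hX : IsStationaryErgodic P X)
    (hq : IsTransitionVersion P X q) (hα : 0 < alpha P X q 0) {u : List A} {p : A → ℝ}
    (hp : ∀ x, EndsIn x u → ∀ a, (q x).real {a} = p a) {d n : ℕ} (hd : 1 ≤ d)
    (hdn : 4 * d < n) (hu : u.length ≤ d) {c κ : ℝ} (hc : 0 < c) (hcn : c ≤ n) (hκ : 0 < κ)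
    (hκ1 : κ ≤ 1) :
    P.real {ω | 1 ≤ count d (sample X n ω) u ∧ ∃ a, κ * c * count d (sample X n ω) u ≤
      ((countNext d (sample X n ω) u a : ℝ) - p a * count d (sample X n ω) u) ^ 2} ≤
      (1 + 2 * Fintype.card A) * Real.exp (-(κ / 128 * c * alpha P X q 0 ^ d / d)) := by
  set α := alpha P X q 0 with hαdef
  have hα1 : α ≤ 1 := by
    have := alpha_zero_le_half (P := P) (X := X) (q := q)
    linarith
  have hd0 : (0 : ℝ) < d := by exact_mod_cast hd
  have hn0 : (0 : ℝ) < n := lt_of_lt_of_le hc hcn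
  -- Since `4d < n`, the number of blocks satisfies `n ≤ 8 m d`, so `s` lies below the threshold `m
  -- α ^ ℓ(u) / 4` of the lower tail bound.
  set s : ℝ := n * α ^ d / (32 * d) with hs
  set m : ℕ := (n - d) / (u.length + 1) with hm
  have hmn : d + m * (u.length + 1) ≤ n := by
    have := Nat.div_mul_le_self (n - d) (u.length + 1)
    rw [← hm] at this
    omega
  have hms : s ≤ m * α ^ u.length / 4 := by
    have h2 : n - d < (m + 1) * (2 * d) := by
      have h := Nat.lt_div_mul_add (a := n - d) (b := u.length + 1) (by omega)
      rw [← hm] at h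
      calc n - d < (m + 1) * (u.length + 1) := by linarith
        _ ≤ (m + 1) * (2 * d) := Nat.mul_le_mul_left _ (by omega)
    have h1 : 1 ≤ m := by
      by_contra h0
      rw [Nat.lt_one_iff.1 (not_le.1 h0)] at h2
      omega
    have h3 : n ≤ 8 * (m * d) := by
      have : (m + 1) * (2 * d) ≤ 2 * m * (2 * d) := Nat.mul_le_mul_right _ (by omega)
      have h4 : 2 * m * (2 * d) = 4 * (m * d) := by ring
      omega
    have h5 : (n : ℝ) ≤ 8 * (m * d) := by exact_mod_cast h3
    calc s ≤ 8 * (m * d) * α ^ d / (32 * d) := by rw [hs]; gcongr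
      _ = m * α ^ d / 4 := by field_simp; ring
      _ ≤ m * α ^ u.length / 4 := by
          have := pow_le_pow_of_le_one hα.le hα1 hu
          gcongr
  -- As `N(u) ≤ n`, a squared deviation of at least `κ c N(u)` is at least `(β N(u))²`. The exponent
  -- `β² s / 4` then equals `κ c α^d / (128 d)`.
  set β : ℝ := √(κ * c / n) with hβ
  have hβ0 : 0 ≤ β := Real.sqrt_nonneg _
  have hβsq : β ^ 2 = κ * c / n := Real.sq_sqrt (by positivity)
  have hβ2 : β ≤ 2 := by
    have : β ≤ 1 := by
      rw [hβ, Real.sqrt_le_one, div_le_one hn0]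
      nlinarith
    linarith
  set R : ℝ := Real.exp (-(κ / 128 * c * α ^ d / d)) with hR
  have hexp₁ : Real.exp (-s) ≤ R := by
    refine Real.exp_le_exp.2 (neg_le_neg ?_)
    rw [hs, div_le_div_iff₀ hd0 (by positivity)]
    have h1 : κ * c ≤ n := by nlinarith
    have h2 : 0 < α ^ d * d := by positivity
    have h3 := mul_le_mul_of_nonneg_right h1 h2.le
    nlinarith [mul_pos hn0 h2]
  have hexp₂ : Real.exp (-(β ^ 2 * s / 4)) = R := by
    rw [hR, hβsq, hs]
    congr 2
    field_simp
    norm_num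
  set B : Set Ω := {ω | (count d (sample X n ω) u : ℝ) ≤ m * α ^ u.length / 4} with hB
  have hBle : P.real B ≤ R := ((measureReal_count_le_le hX hq hα.le u hmn).trans
    (Real.exp_le_exp.2 (neg_le_neg hms))).trans hexp₁
  set E : A → Set Ω := fun a => {ω | (p a + β) * count d (sample X n ω) u ≤
    countNext d (sample X n ω) u a ∧ s ≤ count d (sample X n ω) u} with hE
  set E' : A → Set Ω := fun a => {ω | countNext d (sample X n ω) u a ≤
    (p a - β) * count d (sample X n ω) u ∧ s ≤ count d (sample X n ω) u} with hE'
  have hEle : ∀ a, P.real (E a) ≤ R := fun a => (measureReal_upper_deviation_le hX hq hβ0 hβ2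
    (fun x hx => (hp x hx a).le) s d n).trans_eq hexp₂
  have hEle' : ∀ a, P.real (E' a) ≤ R := fun a => (measureReal_lower_deviation_le hX hq hβ0 hβ2
    (fun x hx => (hp x hx a).ge) s d n).trans_eq hexp₂
  have hsub : {ω | 1 ≤ count d (sample X n ω) u ∧ ∃ a, κ * c * count d (sample X n ω) u ≤
      ((countNext d (sample X n ω) u a : ℝ) - p a * count d (sample X n ω) u) ^ 2} ⊆
      B ∪ ⋃ a, (E a ∪ E' a) := by
    rintro ω ⟨-, a, ha⟩
    by_cases hωB : ω ∈ B
    · exact Or.inl hωB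
    · right
      have hsc : s ≤ count d (sample X n ω) u := hms.trans (not_le.1 hωB).le
      set N : ℝ := (count d (sample X n ω) u : ℝ) with hN
      have hNn : N ≤ n := by
        have := count_le_length d (sample X n ω) u
        rw [sample_length] at this
        exact Nat.cast_le.2 this
      have hN0 : 0 ≤ N := Nat.cast_nonneg _
      have hsq : (β * N) ^ 2 ≤ ((countNext d (sample X n ω) u a : ℝ) - p a * N) ^ 2 := by
        refine le_trans ?_ ha
        rw [mul_pow, hβsq]
        calc κ * c / n * N ^ 2 = κ * c * N * (N / n) := by ring
          _ ≤ κ * c * N := mul_le_of_le_one_right (by positivity) ((div_le_one hn0).2 hNn)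
      have habs := sq_le_sq.1 hsq
      rw [abs_of_nonneg (mul_nonneg hβ0 hN0)] at habs
      refine Set.mem_iUnion.2 ⟨a, ?_⟩
      rcases le_abs.1 habs with h1 | h1
      · exact Or.inl ⟨by linarith, hsc⟩
      · exact Or.inr ⟨by linarith, hsc⟩
  calc _ ≤ P.real (B ∪ ⋃ a, (E a ∪ E' a)) := measureReal_mono hsub (measure_ne_top _ _)
    _ ≤ P.real B + P.real (⋃ a, (E a ∪ E' a)) := measureReal_union_le _ _
    _ ≤ R + ∑ a : A, (R + R) := by
        refine add_le_add hBle ((measureReal_iUnion_fintype_le _).trans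
          (Finset.sum_le_sum fun a _ => (measureReal_union_le _ _).trans ?_))
        exact add_le_add (hEle a) (hEle' a)
    _ = _ := by
        rw [Finset.sum_const, Finset.card_univ, nsmul_eq_mul]
        ring

/-- Bound for the probability of overestimation. -/
theorem exists_overEvent_bound [Nontrivial A] [IsMarkovKernel q] (hX : IsStationaryErgodic P X)
    (hq : IsTransitionVersion P X q) (hreg : Regular P X q) (K : ℕ) :
    ∃ c₃ c₄ : ℝ, 0 < c₃ ∧ 0 < c₄ ∧
      ∀ (d : ℕ → ℕ) (f : ℕ → ℝ) (est : List A → Finset (List A)),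
        IsMaxHeight d → IsPenalizing f → IsPLEstimator d f est →
        ∀ᶠ n in atTop, P.real (overEvent X (contextTree P X q) est K n) ≤
          c₃ * (Fintype.card A : ℝ) ^ d n *
            Real.exp (-(c₄ * f n *
              ((alpha P X q 0) ^ 2 / (Fintype.card A : ℝ)) ^ d n / (d n : ℝ))) := by
  classical
  have hα := hreg.alpha_zero_pos
  have hαhalf := alpha_zero_le_half (P := P) (X := X) (q := q)
  set α := alpha P X q 0 with hαdef
  set N : ℝ := (Fintype.card A : ℝ) with hN
  have hN2 : 2 ≤ N := by
    have : 2 ≤ Fintype.card A := Fintype.one_lt_card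
    rw [hN]
    exact_mod_cast this
  have hN0 : 0 < N := by linarith
  set κ : ℝ := α / (2 * N) with hκ
  have hκ0 : 0 < κ := by positivity
  have hκ1 : κ ≤ 1 := by
    rw [hκ, div_le_one (by positivity)]
    linarith
  set ε : ℝ := α ^ 2 / N with hε
  have hε0 : 0 < ε := by positivity
  -- The argument gives the rate with `α ^ d`; this inequality weakens it to `ε ^ d`.
  have hεα : ε ≤ α := by
    rw [hε, div_le_iff₀ hN0]
    nlinarith
  -- The first summand serves `4d < n`: at most `2 N^d` strings, each with `1 + 2N` bad events. The
  -- summand `e` makes the bound trivial when `n ≤ 4d`.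
  refine ⟨2 * (1 + 2 * N) + Real.exp 1, κ / 128, by positivity, by positivity,
    fun d f est hd hf hest => ?_⟩
  filter_upwards [hf.tendsto_div.eventually (gt_mem_nhds one_pos),
    hd.tendsto_atTop.eventually_ge_atTop 1, eventually_ge_atTop 1] with n hfn hd1 hn1
  have hn0 : (0 : ℝ) < n := by exact_mod_cast hn1
  have hd0 : (0 : ℝ) < d n := by exact_mod_cast hd1
  have hfn' : f n ≤ n := ((div_lt_one hn0).1 hfn).le
  have hf0 := hf.pos n
  have hNd : 1 ≤ N ^ d n := one_le_pow₀ (by linarith)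
  set R : ℝ := Real.exp (-(κ / 128 * f n * ε ^ d n / d n)) with hR
  by_cases hdn : 4 * d n < n
  · have hRle : Real.exp (-(κ / 128 * f n * α ^ d n / d n)) ≤ R := by
      refine Real.exp_le_exp.2 (neg_le_neg ?_)
      gcongr
    -- The reference law is read off any past ending in `u`, so `B u` does not mention the context
    -- `v` and the union bound runs over `u` alone.
    set B : List A → Set Ω := fun u => {ω | ∃ x, EndsIn x u ∧
      (∀ y, EndsIn y u → ∀ a, (q y).real {a} = (q x).real {a}) ∧
      1 ≤ count (d n) (sample X n ω) u ∧ ∃ a, κ * f n * count (d n) (sample X n ω) u ≤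
      ((countNext (d n) (sample X n ω) u a : ℝ) -
        (q x).real {a} * count (d n) (sample X n ω) u) ^ 2} with hB
    have hBle : ∀ u ∈ wordsLE A (d n), P.real (B u) ≤ (1 + 2 * N) * R := by
      intro u hu
      by_cases hex : ∃ x, EndsIn x u ∧ ∀ y, EndsIn y u → ∀ a, (q y).real {a} = (q x).real {a}
      · obtain ⟨x, hx, hxu⟩ := hex
        refine le_trans (measureReal_mono ?_) ((measureReal_far_le hX hq hα hxu hd1 hdn
          (mem_wordsLE.1 hu) hf0 hfn' hκ0 hκ1).trans
          (mul_le_mul_of_nonneg_left hRle (by positivity)))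
        rintro ω ⟨x', hx', -, hc, a, ha⟩
        rw [hxu x' hx' a] at ha
        exact ⟨hc, a, ha⟩
      · have : B u = ∅ := Set.eq_empty_of_forall_notMem fun ω ⟨x, hx, hxu, _⟩ =>
          hex ⟨x, hx, hxu⟩
        rw [this, measureReal_empty]
        positivity
    have hsub : overEvent X (contextTree P X q) est K n ⊆ ⋃ u ∈ wordsLE A (d n), B u := by
      rintro ω ⟨v, w, hv, -, hvw, hw⟩
      obtain ⟨hvw, hne⟩ := properSuffix_inl_iff.1 hvw
      have hnil : sample X n ω ≠ [] := by
        intro h0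
        have := sample_length X n ω
        rw [h0, List.length_nil] at this
        omega
      obtain ⟨hfeas, hmin⟩ := hest _ hnil
      rw [sample_length] at hfeas hmin
      have hdet : Determines P X q v := (show IsContext P X q v from hv).1
      obtain ⟨z, hz⟩ := exists_endsIn v
      have hp : ∀ a, α ≤ (q z).real {a} := fun a => alpha_zero_le z a
      obtain ⟨u, hu, hvu, hfar⟩ := hfeas.exists_far_leaf hf0 hmin hw hvw hne
        (fun a => (q z).real {a}) (fun a => hα.trans_le (hp a)) (sum_kernel_real q z)
      obtain ⟨x, hx⟩ := exists_endsIn u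
      have hxz : ∀ y, EndsIn y u → ∀ a, (q y).real {a} = (q z).real {a} := fun y hy a =>
        (hdet y (hy.of_suffix hvu) a).trans (hdet z hz a).symm
      refine Set.mem_iUnion₂.2 ⟨u, mem_wordsLE.2 (hfeas.length_le hu), x, hx,
        fun y hy a => (hxz y hy a).trans (hxz x hx a).symm, hfeas.occurs u hu, ?_⟩
      have hcount := hfeas.occurs u hu
      have hcount0 : (0 : ℝ) < count (d n) (sample X n ω) u := by exact_mod_cast hcount
      by_contra! hcon
      have hchi := hfar.trans (logLik_sub_le_chiSq (d n) (sample X n ω) u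
        (fun a => (q z).real {a}) (fun a => hα.trans_le (hp a)) (sum_kernel_real q z) hcount)
      have hlt : ∑ a, ((countNext (d n) (sample X n ω) u a : ℝ) -
          (q z).real {a} * count (d n) (sample X n ω) u) ^ 2 /
          ((q z).real {a} * count (d n) (sample X n ω) u) < ∑ a : A, f n / (2 * N) := by
        refine Finset.sum_lt_sum_of_nonempty Finset.univ_nonempty fun a _ => ?_
        have h1 := hcon a
        rw [hxz x hx a] at h1
        have h2 := hα.trans_le (hp a)
        rw [div_lt_iff₀ (by positivity)]
        refine h1.trans_le ?_
        calc κ * f n * count (d n) (sample X n ω) u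
            = f n / (2 * N) * (α * count (d n) (sample X n ω) u) := by rw [hκ]; ring
          _ ≤ _ := by
              have := hp a
              gcongr
      have hsum : ∑ a : A, f n / (2 * N) = f n / 2 := by
        rw [Finset.sum_const, Finset.card_univ, nsmul_eq_mul, ← hN]
        field_simp
      linarith
    have hcard : ((wordsLE A (d n)).card : ℝ) ≤ 2 * N ^ d n := by
      rw [hN]
      exact_mod_cast card_wordsLE_le (A := A) (d n)
    calc P.real (overEvent X (contextTree P X q) est K n)
        ≤ P.real (⋃ u ∈ wordsLE A (d n), B u) := measureReal_mono hsub (measure_ne_top _ _)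
      _ ≤ ∑ u ∈ wordsLE A (d n), P.real (B u) := measureReal_biUnion_finset_le _ _
      _ ≤ ∑ u ∈ wordsLE A (d n), (1 + 2 * N) * R := Finset.sum_le_sum hBle
      _ = (wordsLE A (d n)).card * ((1 + 2 * N) * R) := by
          rw [Finset.sum_const, nsmul_eq_mul]
      _ ≤ 2 * N ^ d n * ((1 + 2 * N) * R) := by
          have hR0 : 0 < R := Real.exp_pos _
          gcongr
      _ ≤ (2 * (1 + 2 * N) + Real.exp 1) * N ^ d n * R := by
          have : 0 ≤ Real.exp 1 * (N ^ d n * R) := by positivity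
          linarith
  -- Here `f n ≤ n ≤ 4 d n`, so the exponent is bounded and the claimed bound exceeds one.
  · have hθ : κ / 128 * f n * ε ^ d n / d n ≤ 1 := by
      rw [div_le_one hd0]
      have h1 : (n : ℝ) ≤ 4 * d n := by exact_mod_cast not_lt.1 hdn
      have h2 : ε ^ d n ≤ 1 := pow_le_one₀ hε0.le (by linarith)
      have h3 : κ / 128 * f n ≤ d n := by nlinarith
      have h4 : 0 ≤ κ / 128 * f n := by positivity
      exact (mul_le_of_le_one_right h4 h2).trans h3
    have hR1 : Real.exp (-1) ≤ R := Real.exp_le_exp.2 (neg_le_neg hθ)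
    have h1 : P.real (overEvent X (contextTree P X q) est K n) ≤ 1 := measureReal_le_one
    refine h1.trans ?_
    calc (1 : ℝ) = Real.exp 1 * 1 * Real.exp (-1) := by rw [mul_one, ← Real.exp_add]; simp
      _ ≤ (2 * (1 + 2 * N) + Real.exp 1) * N ^ d n * R := by
          have : 0 ≤ 2 * (1 + 2 * N) := by positivity
          gcongr
          linarith

end Rates

end PLTree

theorem theorem1 {Ω A : Type*} [MeasurableSpace Ω] [Fintype A] [DecidableEq A] [Nontrivial A]
    [MeasurableSpace A] [MeasurableSingletonClass A]
    (P : Measure Ω) [IsProbabilityMeasure P] (X : ℤ → Ω → A)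
    (hX : PLTree.IsStationaryErgodic P X)
    (q : Kernel (ℕ → A) A) [IsMarkovKernel q] (hq : PLTree.IsTransitionVersion P X q)
    (hreg : PLTree.Regular P X q) (K : ℕ) :
    ∃ c₁ c₂ c₃ c₄ : ℝ, 0 < c₁ ∧ 0 < c₂ ∧ 0 < c₃ ∧ 0 < c₄ ∧
      ∀ (d : ℕ → ℕ) (f : ℕ → ℝ) (est : List A → Finset (List A)),
        PLTree.IsMaxHeight d → PLTree.IsPenalizing f → PLTree.IsPLEstimator d f est →
        ∃ n₀ : ℕ, ∀ n ≥ n₀,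
          (Tendsto (fun m : ℕ => f m / ((m : ℝ) - (d m : ℝ))) atTop (𝓝 0) →
            P.real (PLTree.underEvent X (PLTree.contextTree P X q) est K n)
              ≤ c₁ * Real.exp (-(c₂ * ((n : ℝ) - (d n : ℝ))))) ∧
          P.real (PLTree.overEvent X (PLTree.contextTree P X q) est K n)
            ≤ c₃ * (Fintype.card A : ℝ) ^ d n *
              Real.exp (-(c₄ * f n *
                ((PLTree.alpha P X q 0) ^ 2 / (Fintype.card A : ℝ)) ^ d n / (d n : ℝ))) := by

  obtain ⟨c₁, c₂, hc₁, hc₂, hunder⟩ := PLTree.exists_underEvent_bound hX hq hreg K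
  obtain ⟨c₃, c₄, hc₃, hc₄, hover⟩ := PLTree.exists_overEvent_bound hX hq hreg K
  refine ⟨c₁, c₂, c₃, c₄, hc₁, hc₂, hc₃, hc₄, fun d f est hd hf hest => ?_⟩
  refine eventually_atTop.1 (Eventually.and ?_ (hover d f est hd hf hest))
  -- The growth condition of (a) does not involve `n`, so it is decided before `n₀` is fixed.
  by_cases hlim : Tendsto (fun m : ℕ => f m / ((m : ℝ) - (d m : ℝ))) atTop (𝓝 0)
  · exact (hunder d f est hd hf hest hlim).mono fun n hn _ => hn
  · exact Eventually.of_forall fun n h => absurd h hlim
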